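/- Let $k \ge 2$ be an integer and let $\psi : \mathbb{N} = \{1,2,\dots\} \to [0,1/2]$ be non-increasing with $\psi(n) \to 0$ as $n \to \infty$. For $x \in \mathbb{R}$ write $\|x\| = \inf_{m \in \mathbb{Z}} |x-m|$. For $\boldsymbol\alpha = (\alpha_1,\dots,\alpha_k) \in \mathbb{R}^k$ and $N \in \mathbb{N}$, let $S^\times_{\mathbf 0}(\boldsymbol\alpha,N,\psi)$ be the number of positive integers $n \le N$ with $\|n\alpha_1\| \cdots \|n\alpha_k\| < \psi(n)$, and put $$\Psi_k^\times(N) = \frac{1}{(k-1)!} \sum_{n \le N} \psi(n)\,\bigl(-\log(2^k\psi(n))\bigr)^{k-1},$$ where a term with $\psi(n)=0$ is read as $0$. Assume that $\Psi_k^\times(N)$ is unbounded as $N$ varies. Then, for almost all $\boldsymbol\alpha \in \mathbb{R}^k$ (with respect to Lebesgue measure), $$S^\times_{\mathbf 0}(\boldsymbol\alpha,N,\psi) \sim 2^k\, \Psi_k^\times(N) \qquad (N \to \infty).$$ Moreover the asymptotic holds almost uniformly on sets of finite measure: for every measurable $K \subseteq \mathbb{R}^k$ of finite Lebesgue measure and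 every $\varepsilon > 0$ there is a measurable set $E \subseteq \mathbb{R}^k$ of measure at most $\varepsilon$ such that $S^\times_{\mathbf 0}(\boldsymbol\alpha,N,\psi) / \Psi_k^\times(N) \to 2^k$ as $N \to \infty$, uniformly for $\boldsymbol\alpha \in K \setminus E$. -/

import Mathlib

open Filter MeasureTheory

noncomputable section

namespace LittlewoodCounting

/-- The distance from a real number `x` to the nearest integer, `‖x‖ = inf_{m ∈ ℤ} |x - m|`. -/
def distInt (x : ℝ) : ℝ := ⨅ m : ℤ, |x - (m : ℝ)|

/-- The infimum is attained at the rounding of `x`. -/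
theorem distInt_eq_abs_sub_round (x : ℝ) : distInt x = |x - (round x : ℝ)| := by
  apply le_antisymm
  · exact ciInf_le ⟨0, by rintro _ ⟨m, rfl⟩; exact abs_nonneg _⟩ (round x)
  · exact le_ciInf fun m => round_le x m

open Classical in
/-- `S^×_γ(α, N, ψ)`: the number of positive integers `n ≤ N` with
`‖n α₁ - γ₁‖ ⋯ ‖n α_k - γ_k‖ < ψ(n)`. -/
def countMul {k : ℕ} (γ α : Fin k → ℝ) (N : ℕ) (ψ : ℕ → ℝ) : ℕ :=
  ((Finset.Icc 1 N).filter fun n : ℕ => ∏ i, distInt ((n : ℝ) * α i - γ i) < ψ n).card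

/-- `Ψ_k^×(N) = (1 / (k-1)!) ∑_{1 ≤ n ≤ N} ψ(n) (-log (2^k ψ(n)))^(k-1)`, for `k ≥ 1`.
A term with `ψ(n) = 0` is `0`. -/
def PsiMul (k : ℕ) (ψ : ℕ → ℝ) (N : ℕ) : ℝ :=
  1 / ((k - 1).factorial : ℝ) *
    ∑ n ∈ Finset.Icc 1 N, ψ n * (-Real.log (2 ^ k * ψ n)) ^ (k - 1)

end LittlewoodCounting

end

/-!
The counting function `S_N(α)` of the `n ≤ N` with `‖n α₁‖ ⋯ ‖n α_k‖ < ψ(n)` is compared with its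
mean `V(N)` over the unit cube by a second moment estimate.

*Mean.* For a uniform point of the cube the distances `‖n αᵢ‖` are independent and uniform on
`(0, 1/2]`, so the `n`-th event has probability `hyperVol k (2 ^ k ψ(n))`, where
`hyperVol k t = t ∑_{j < k} (-log t) ^ j / j!` for `t ≤ 1`. Its leading term as
`t → 0` is the summand of `2 ^ k Ψ_k`, so `V(N)` is asymptotic to `2 ^ k Ψ_k(N)`.

*Correlations.* In one coordinate, `‖m x‖ ≤ s` and `‖n x‖ ≤ t` hold together with probability at
most `4 s t + 2 gcd(m, n) min(s / m, t / n)` (`unitMeasure_distInt_le_and_le`, which is used for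
both orders of `m` and `n`). This is the mass that a product measure plus a measure on a line
through the origin gives to `[0, s] × [0, t]`. The events cut out rectangles of this kind in each
coordinate when the other coordinates are fixed, so the joint law may be replaced by this majorant
one coordinate at a time (`scaleAvg_iterate_le_of_le`). Expanding the product
(`scaleAvg_majorantMeasure_iterate_le`), the terms with no factor from the line give the product
of the two probabilities, those with at least two such factors are small because of
`(gcd(m, n) / n) ^ 2`, and those with exactly one contribute `(gcd(m, n) / n) (ψ(n) √(n / m) + ψ(m) m / n)` up
to a constant (`cubeMeasure_inter_le`). The exponents of `n / m` in the last bound make it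
summable over `m` and over `n` respectively without a further logarithm.

*Second moment.* Summing over `m ≤ n ≤ N` leaves `∑ ψ(n) τ(n)`, with `τ` the number of divisors.
As `ψ` is antitone this is at most `∑ ψ(n) (2 + log n)`, and as `k ≥ 2` the logarithm is absorbed
by the one in `hyperVol`, unless `ψ(n)` is so large that `√n ≤ V(N)`. Hence the variance of `S_N`
is `O(V(N) (1 + √V(N)))` (`exists_integral_sq_le`).

*Conclusion.* Along the indices at which `V` reaches the fourth powers the relative variances are
summable, which gives `S_N / V(N) → 1` almost everywhere along them, and by monotonicity for all
`N`. The set of convergence is invariant under integer translations, so it is conull in `ℝᵏ`, and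
the uniform statement is Egorov's theorem.
-/

noncomputable section

namespace LittlewoodCounting

/-! ### Distance to the nearest integer -/

theorem distInt_nonneg (x : ℝ) : 0 ≤ distInt x := by
  rw [distInt_eq_abs_sub_round]
  exact abs_nonneg _

theorem distInt_le_half (x : ℝ) : distInt x ≤ 1 / 2 := by
  rw [distInt_eq_abs_sub_round]
  exact abs_sub_round x

theorem distInt_add_int (x : ℝ) (z : ℤ) : distInt (x + z) = distInt x := by
  rw [distInt_eq_abs_sub_round, distInt_eq_abs_sub_round, round_add_intCast]
  push_cast
  congr 1
  ring

@[fun_prop]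
theorem measurable_distInt : Measurable distInt := by
  have h : distInt = fun x : ℝ => min (Int.fract x) (1 - Int.fract x) := by
    funext x
    rw [distInt_eq_abs_sub_round, abs_sub_round_eq_min]
  rw [h]
  exact measurable_fract.min (measurable_const.sub measurable_fract)

theorem norm_coe_unitAddCircle (x : ℝ) : ‖(x : UnitAddCircle)‖ = distInt x := by
  rw [UnitAddCircle.norm_eq, distInt_eq_abs_sub_round]

/-! ### One coordinate: the joint law of the distances of two multiples -/

/-- Lebesgue measure on the unit interval `(0, 1]`. -/
def unitMeasure : Measure ℝ := volume.restrict (Set.Ioc 0 1)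

instance : IsProbabilityMeasure unitMeasure :=
  ⟨by simp [unitMeasure]⟩

/-- The uniform probability measure on `(0, 1/2]`, presented as the law of half of a uniform
point of `(0, 1]`. -/
def halfMeasure : Measure ℝ := unitMeasure.map (fun z => z / 2)

instance : IsProbabilityMeasure halfMeasure :=
  Measure.isProbabilityMeasure_map (by fun_prop)

theorem lintegral_unitMeasure_add {f : ℝ → ENNReal} (hf : ∀ (z : ℤ) (x : ℝ), f (x + z) = f x)
    (c : ℝ) : ∫⁻ x, f (x + c) ∂unitMeasure = ∫⁻ x, f x ∂unitMeasure := by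
  have hper : ∀ (g : AddSubgroup.zmultiples (1 : ℝ)) (x : ℝ), f (g +ᵥ x) = f x := by
    rintro ⟨g, hg⟩ x
    obtain ⟨z, rfl⟩ := AddSubgroup.mem_zmultiples_iff.mp hg
    simpa [AddSubmonoid.vadd_def, AddSubgroup.vadd_def, add_comm] using hf z x
  have h1 := (isAddFundamentalDomain_Ioc (T := (1 : ℝ)) one_pos c volume).setLIntegral_eq
    (isAddFundamentalDomain_Ioc (T := (1 : ℝ)) one_pos 0 volume) f hper
  rw [zero_add] at h1
  rw [unitMeasure, ← h1]
  have h2 := (measurePreserving_add_right (volume : Measure ℝ) c).setLIntegral_comp_preimage_emb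
    (MeasurableEquiv.addRight c).measurableEmbedding f (Set.Ioc c (c + 1))
  rw [← h2]
  congr 2
  ext x
  simp

theorem unitMeasure_distInt_le {m : ℕ} (hm : 0 < m) {s : ℝ} (hs : s ≤ 1 / 2) :
    unitMeasure {x | distInt (m * x) ≤ s} = ENNReal.ofReal (2 * s) := by
  have hmp := UnitAddCircle.measurePreserving_mk 0
  have hpow : MeasurePreserving (fun y : UnitAddCircle => m • y) volume volume := by
    rcases Nat.lt_or_ge 1 m with h | h
    · exact (AddCircle.ergodic_nsmul h).toMeasurePreserving
    · obtain rfl : m = 1 := by omega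
      simp only [one_smul]
      exact MeasurePreserving.id (volume : Measure UnitAddCircle)
  have h := (hpow.comp hmp).measure_preimage
    (Metric.isClosed_closedBall (x := (0 : UnitAddCircle)) (ε := s)).measurableSet.nullMeasurableSet
  rw [AddCircle.volume_closedBall, min_eq_right (by linarith), zero_add] at h
  rw [← h, unitMeasure]
  congr 1
  ext x
  have : m • (x : UnitAddCircle) = ((m * x : ℝ) : UnitAddCircle) := by
    rw [← AddCircle.coe_nsmul, nsmul_eq_mul]
  simp only [Set.mem_ofPred_eq, Set.mem_preimage, Function.comp_apply, mem_closedBall_zero_iff]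
  change _ ↔ ‖m • (x : UnitAddCircle)‖ ≤ s
  rw [this, norm_coe_unitAddCircle]

theorem unitMeasure_Iic {s : ℝ} (hs : s ≤ 1) : unitMeasure (Set.Iic s) = ENNReal.ofReal s := by
  rw [unitMeasure, Measure.restrict_apply measurableSet_Iic, Set.inter_comm, Set.Ioc_inter_Iic,
    min_eq_right hs, Real.volume_Ioc, sub_zero]

theorem map_distInt {m : ℕ} (hm : 0 < m) :
    unitMeasure.map (fun x => distInt (m * x)) = halfMeasure := by
  have hmeas : Measurable fun x : ℝ => distInt (m * x) := by fun_prop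
  have : IsProbabilityMeasure (unitMeasure.map (fun x => distInt (m * x))) :=
    Measure.isProbabilityMeasure_map hmeas.aemeasurable
  refine Measure.ext_of_Iic _ _ fun s => ?_
  rw [Measure.map_apply hmeas measurableSet_Iic, halfMeasure,
    Measure.map_apply (by fun_prop) measurableSet_Iic]
  have hpre : (fun z : ℝ => z / 2) ⁻¹' Set.Iic s = Set.Iic (2 * s) := by
    ext z
    simp only [Set.mem_preimage, Set.mem_Iic]
    constructor <;> intro h <;> linarith
  rw [hpre]
  rcases le_total s (1 / 2) with hs | hs
  · rw [unitMeasure_Iic (by linarith)]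
    exact unitMeasure_distInt_le hm hs
  · have h1 : (fun x : ℝ => distInt (m * x)) ⁻¹' Set.Iic s = Set.univ :=
      Set.eq_univ_of_forall fun x => (distInt_le_half _).trans hs
    have h2 : unitMeasure (Set.Iic (2 * s))ᶜ = 0 := by
      rw [unitMeasure, Measure.restrict_apply measurableSet_Iic.compl]
      convert measure_empty (μ := (volume : Measure ℝ))
      ext z
      simp
      intro h _
      linarith
    rw [h1, measure_univ, (prob_compl_eq_zero_iff measurableSet_Iic).mp h2]

/-- Among the `m` translates of `y` by the multiples of `n / m`, at most `2 t m + gcd(m, n)` lie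
within `t` of an integer: `a` determines the integer `n a - m p`, with `p` the nearest integer,
which is a multiple of the gcd in an interval of length `2 t m`, and determines `a` up to
multiples of `m / gcd(m, n)`. -/
theorem card_distInt_translates_le {m : ℕ} (hm : 0 < m) (n : ℕ) (y : ℝ) {t : ℝ} (ht : 0 ≤ t) :
    (((Finset.range m).filter fun a : ℕ => distInt (y + n * (a / m)) ≤ t).card : ℝ) ≤
      2 * t * m + Nat.gcd m n := by
  set d := Nat.gcd m n with hd
  have hd0 : 0 < d := Nat.gcd_pos_of_pos_left n hm
  obtain ⟨m', hm'⟩ : d ∣ m := Nat.gcd_dvd_left m n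
  obtain ⟨n', hn'⟩ : d ∣ n := Nat.gcd_dvd_right m n
  have hm'0 : 0 < m' := by
    rcases Nat.eq_zero_or_pos m' with h | h
    · simp [h] at hm'; omega
    · exact h
  have hcop : Nat.Coprime m' n' := by
    have := Nat.gcd_mul_left d m' n'
    rw [← hm', ← hn', ← hd] at this
    exact Nat.eq_of_mul_eq_mul_left hd0 (by rw [mul_one]; exact this.symm)
  have hmR : (0 : ℝ) < m := by exact_mod_cast hm
  have hdR : (0 : ℝ) < d := by exact_mod_cast hd0
  have hm'R : (m : ℝ) = d * m' := by exact_mod_cast hm'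
  have hn'R : (n : ℝ) = d * n' := by exact_mod_cast hn'
  set A := (Finset.range m).filter fun a : ℕ => distInt (y + n * (a / m)) ≤ t with hA
  let w : ℕ → ℤ := fun a => n' * a - m' * round (y + n * ((a : ℝ) / m))
  have hfib : ∀ b ∈ A.image w, (A.filter fun a => w a = b).card ≤ d := by
    intro b _
    rw [← Finset.card_range d]
    refine Finset.card_le_card_of_injOn (fun a => a / m') ?_ ?_
    · intro a ha
      simp only [hA, Finset.coe_filter, Finset.mem_filter, Finset.mem_range, Set.mem_ofPred_eq]
        at ha
      simp only [Finset.coe_range, Set.mem_Iio]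
      exact Nat.div_lt_of_lt_mul (by rw [mul_comm, ← hm']; exact ha.1.1)
    · intro a ha a' ha' haa
      simp only [Finset.coe_filter, Set.mem_ofPred_eq] at ha ha'
      have h1 : w a = w a' := ha.2.trans ha'.2.symm
      have h2 : (m' : ℤ) ∣ n' * ((a : ℤ) - a') := by
        refine ⟨round (y + n * ((a : ℝ) / m)) - round (y + n * ((a' : ℝ) / m)), ?_⟩
        simp only [w] at h1
        linarith
      have h3 : (m' : ℤ) ∣ (a : ℤ) - a' :=
        (Int.isCoprime_iff_gcd_eq_one.mpr (by simpa using hcop)).dvd_of_dvd_mul_left h2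
      have h4 : a % m' = a' % m' := by
        have h6 : (a : ℤ) ≡ a' [ZMOD m'] := (Int.modEq_iff_dvd.mpr (by
          rw [← neg_sub]; exact (dvd_neg.mpr h3)))
        exact (Int.natCast_modEq_iff.mp h6)
      rw [← Nat.div_add_mod a m', ← Nat.div_add_mod a' m', h4]
      simp only at haa
      rw [haa]
  have himg : A.image w ⊆ Finset.Icc ⌈(-(y + t) * m' : ℝ)⌉ ⌊((t - y) * m' : ℝ)⌋ := by
    intro b hb
    obtain ⟨a, ha, rfl⟩ := Finset.mem_image.mp hb
    simp only [hA, Finset.mem_filter, distInt_eq_abs_sub_round] at ha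
    have h := abs_le.mp ha.2
    have hm'pos : (0 : ℝ) < m' := by exact_mod_cast hm'0
    have key : ((w a : ℤ) : ℝ) = m' * (n * ((a : ℝ) / m) - round (y + n * ((a : ℝ) / m))) := by
      simp only [w]
      push_cast
      rw [hn'R, hm'R]
      field_simp
    rw [Finset.mem_Icc, Int.ceil_le, Int.le_floor, key]
    constructor <;> nlinarith [h.1, h.2]
  have hcard : ((A.image w).card : ℝ) ≤ 2 * t * m' + 1 := by
    have h0 : ((A.image w).card : ℝ) ≤
        ((Finset.Icc ⌈(-(y + t) * m' : ℝ)⌉ ⌊((t - y) * m' : ℝ)⌋).card : ℝ) := by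
      exact_mod_cast Finset.card_le_card himg
    refine h0.trans ?_
    rw [Int.card_Icc]
    have hm'pos : (0 : ℝ) < m' := by exact_mod_cast hm'0
    have h1 := Int.le_ceil (-(y + t) * m' : ℝ)
    have h2 := Int.floor_le ((t - y) * m' : ℝ)
    have h3 : (((⌊((t - y) * m' : ℝ)⌋ + 1 - ⌈(-(y + t) * m' : ℝ)⌉).toNat : ℤ) : ℝ) ≤
        2 * t * m' + 1 := by
      rw [Int.toNat_eq_max]
      push_cast
      refine max_le (by nlinarith) (by positivity)
    exact_mod_cast h3
  have hAle : (A.card : ℝ) ≤ d * ((A.image w).card : ℝ) := by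
    exact_mod_cast Finset.card_le_mul_card_image A d hfib
  calc (A.card : ℝ) ≤ d * ((A.image w).card : ℝ) := hAle
    _ ≤ d * (2 * t * m' + 1) := by gcongr
    _ = 2 * t * m + d := by rw [hm'R]; ring

/-- The distances of `m x` and `n x` to the nearest integer are independent up to a
gcd term. The set is averaged over the translations by multiples of `1 / m`, which do not change
the first condition. -/
theorem unitMeasure_distInt_le_and_le {m : ℕ} (hm : 0 < m) (n : ℕ) {s t : ℝ} (hs : s ≤ 1 / 2)
    (ht : 0 ≤ t) :
    unitMeasure {x | distInt (m * x) ≤ s ∧ distInt (n * x) ≤ t} ≤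
      ENNReal.ofReal (4 * s * t + 2 * Nat.gcd m n * (s / m)) := by
  classical
  have hmR : (0 : ℝ) < m := by exact_mod_cast hm
  set S := {x : ℝ | distInt (m * x) ≤ s ∧ distInt (n * x) ≤ t} with hS
  have hSm : MeasurableSet S := by
    apply MeasurableSet.inter
    · exact measurableSet_le (f := fun x : ℝ => distInt (m * x)) (by fun_prop) measurable_const
    · exact measurableSet_le (f := fun x : ℝ => distInt (n * x)) (by fun_prop) measurable_const
  have hS1 : MeasurableSet {x : ℝ | distInt (m * x) ≤ s} :=
    measurableSet_le (by fun_prop) measurable_const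
  let f : ℝ → ENNReal := S.indicator fun _ => 1
  have hper : ∀ (z : ℤ) (x : ℝ), f (x + z) = f x := by
    intro z x
    have h1 : distInt (m * (x + z)) = distInt (m * x) := by
      rw [← distInt_add_int (m * x) (m * z)]
      push_cast
      ring_nf
    have h2 : distInt (n * (x + z)) = distInt (n * x) := by
      rw [← distInt_add_int (n * x) (n * z)]
      push_cast
      ring_nf
    have h3 : x + z ∈ S ↔ x ∈ S := by simp only [hS, Set.mem_ofPred_eq, h1, h2]
    by_cases hx : x ∈ S
    · simp only [f, Set.indicator_of_mem hx, Set.indicator_of_mem (h3.mpr hx)]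
    · simp only [f, Set.indicator_of_notMem hx, Set.indicator_of_notMem (mt h3.mp hx)]
  -- Translation invariance over one period, summed over the translates.
  have havg : (m : ENNReal) * unitMeasure S =
      ∫⁻ x, ∑ a ∈ Finset.range m, f (x + a / m) ∂unitMeasure := by
    rw [lintegral_finsetSum _ fun a _ => by
      exact (measurable_const.indicator hSm).comp (measurable_id.add_const _)]
    rw [Finset.sum_congr rfl fun (a : ℕ) _ => lintegral_unitMeasure_add hper ((a : ℝ) / m)]
    rw [Finset.sum_const, Finset.card_range, nsmul_eq_mul, lintegral_indicator_const hSm, one_mul]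
  have hle : ∀ x, ∑ a ∈ Finset.range m, f (x + a / m) ≤
      Set.indicator {x : ℝ | distInt (m * x) ≤ s}
        (fun _ => ENNReal.ofReal (2 * t * m + Nat.gcd m n)) x := by
    intro x
    have h1 : ∀ a : ℕ, distInt (m * (x + a / m)) = distInt (m * x) := by
      intro a
      rw [← distInt_add_int (m * x) a]
      congr 1
      field_simp
      push_cast
      ring
    by_cases hx : distInt (m * x) ≤ s
    · rw [Set.indicator_of_mem (by exact hx)]
      have h2 : ∑ a ∈ Finset.range m, f (x + a / m) =
          (((Finset.range m).filter fun a : ℕ => distInt (n * x + n * (a / m)) ≤ t).card :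
            ENNReal) := by
        rw [Finset.card_filter]
        push_cast
        refine Finset.sum_congr rfl fun a _ => ?_
        simp only [f, Set.indicator, hS, Set.mem_ofPred_eq, h1, hx, true_and, mul_add (n : ℝ)]
      rw [h2, ← ENNReal.ofReal_natCast]
      exact ENNReal.ofReal_le_ofReal (card_distInt_translates_le hm n (n * x) ht)
    · rw [Set.indicator_of_notMem (by exact hx)]
      refine le_of_eq (Finset.sum_eq_zero fun a _ => Set.indicator_of_notMem ?_ _)
      simp only [hS, Set.mem_ofPred_eq, h1]
      exact fun h => hx h.1
  have hmain : (m : ENNReal) * unitMeasure S ≤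
      ENNReal.ofReal (2 * t * m + Nat.gcd m n) * ENNReal.ofReal (2 * s) := by
    rw [havg]
    refine (lintegral_mono hle).trans (le_of_eq ?_)
    rw [lintegral_indicator_const hS1, unitMeasure_distInt_le hm hs]
  have hm0 : (m : ENNReal) ≠ 0 := by simpa using hm.ne'
  rw [← ENNReal.mul_le_mul_iff_right hm0 (ENNReal.natCast_ne_top m)]
  refine hmain.trans (le_of_eq ?_)
  rw [← ENNReal.ofReal_natCast m, ← ENNReal.ofReal_mul (by positivity),
    ← ENNReal.ofReal_mul (by positivity)]
  congr 1
  field_simp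
  ring

/-! ### Averages over random scalings -/

section ScaleAvg

variable {M : Type*} [CommMonoid M] [MeasurableSpace M]

/-- The average of `f` over the multiples `x * p` of its argument, with `p` distributed according
to `ρ`. Iterating it `k` times averages `f` over the products of `k` independent factors. -/
def scaleAvg (ρ : Measure M) (f : M → ENNReal) (x : M) : ENNReal := ∫⁻ p, f (x * p) ∂ρ

theorem scaleAvg_mono (ρ : Measure M) {f g : M → ENNReal} (h : f ≤ g) :
    scaleAvg ρ f ≤ scaleAvg ρ g :=
  fun x => lintegral_mono fun p => h (x * p)

theorem scaleAvg_add_measure (ρ σ : Measure M) (f : M → ENNReal) :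
    scaleAvg (ρ + σ) f = scaleAvg ρ f + scaleAvg σ f := by
  funext x
  exact lintegral_add_measure _ _ _

theorem scaleAvg_smul_measure (c : ENNReal) (ρ : Measure M) (f : M → ENNReal) :
    scaleAvg (c • ρ) f = fun x => c * scaleAvg ρ f x := by
  funext x
  simp [scaleAvg, lintegral_smul_measure]

variable [MeasurableMul₂ M]

theorem measurable_scaleAvg (ρ : Measure M) [SFinite ρ] {f : M → ENNReal} (hf : Measurable f) :
    Measurable (scaleAvg ρ f) :=
  Measurable.lintegral_prod_right' (f := fun z : M × M => f (z.1 * z.2))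
    (hf.comp measurable_mul)

theorem measurable_scaleAvg_iterate (ρ : Measure M) [SFinite ρ] {f : M → ENNReal}
    (hf : Measurable f) (k : ℕ) : Measurable ((scaleAvg ρ)^[k] f) := by
  induction k with
  | zero => exact hf
  | succ k ih =>
    rw [Function.iterate_succ_apply']
    exact measurable_scaleAvg ρ ih

theorem scaleAvg_comm (ρ σ : Measure M) [SFinite ρ] [SFinite σ] {f : M → ENNReal}
    (hf : Measurable f) : scaleAvg ρ (scaleAvg σ f) = scaleAvg σ (scaleAvg ρ f) := by
  funext x
  simp only [scaleAvg]
  rw [lintegral_lintegral_swap (by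
    apply Measurable.aemeasurable
    exact hf.comp (by fun_prop : Measurable fun z : M × M => x * z.1 * z.2))]
  refine lintegral_congr fun q => lintegral_congr fun p => ?_
  rw [mul_right_comm]

theorem scaleAvg_add (ρ : Measure M) {f g : M → ENNReal} (hf : Measurable f) :
    scaleAvg ρ (f + g) = scaleAvg ρ f + scaleAvg ρ g := by
  funext x
  exact lintegral_add_left (hf.comp (measurable_const_mul x)) _

theorem scaleAvg_const_smul (ρ : Measure M) {f : M → ENNReal} (hf : Measurable f) (c : ENNReal) :
    scaleAvg ρ (fun x => c * f x) = fun x => c * scaleAvg ρ f x := by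
  funext x
  exact lintegral_const_mul c (hf.comp (measurable_const_mul x))

theorem scaleAvg_comp_snd {N : Type*} [CommMonoid N] [MeasurableSpace N] [MeasurableMul₂ N]
    (ρ : Measure (N × M)) {g : M → ENNReal} (hg : Measurable g) :
    scaleAvg ρ (g ∘ Prod.snd) = scaleAvg (ρ.map Prod.snd) g ∘ Prod.snd := by
  funext x
  simp only [scaleAvg, Function.comp_apply, Prod.snd_mul]
  exact (lintegral_map (hg.comp (measurable_const_mul x.2)) measurable_snd).symm

/-- Iterated averages are expectations over products of independent factors. -/
theorem lintegral_pi_mul_prod_eq_iterate (P : Measure ℝ) [IsProbabilityMeasure P] {u : ℝ → M}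
    (hu : Measurable u) {f : M → ENNReal} (hf : Measurable f) (k : ℕ) (x : M) :
    ∫⁻ α : Fin k → ℝ, f (x * ∏ i, u (α i)) ∂Measure.pi (fun _ => P) =
      (scaleAvg (P.map u))^[k] f x := by
  induction k generalizing x with
  | zero =>
    simp
  | succ k ih =>
    have hmp := (measurePreserving_piFinSuccAbove (fun _ : Fin (k + 1) => P) 0).symm
    have hF : Measurable fun α : Fin (k + 1) → ℝ => f (x * ∏ i, u (α i)) := by
      apply hf.comp
      apply Measurable.const_mul
      exact Finset.measurable_prod _ fun i _ => hu.comp (measurable_pi_apply i)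
    rw [← hmp.lintegral_comp hF, lintegral_prod _ (by
        exact (hF.comp hmp.measurable).aemeasurable), Function.iterate_succ_apply']
    refine Eq.trans ?_ (lintegral_map
      ((measurable_scaleAvg_iterate _ hf k).comp (measurable_const_mul x)) hu).symm
    refine lintegral_congr fun a => ?_
    rw [Function.comp_apply]
    rw [← ih]
    refine lintegral_congr fun β => ?_
    congr 1
    rw [Fin.prod_univ_succ, mul_assoc]
    simp [MeasurableEquiv.piFinSuccAbove]

end ScaleAvg

theorem scaleAvg_prod_mul {ρ σ : Measure ℝ} [SFinite ρ] [SFinite σ] {F G : ℝ → ENNReal}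
    (hF : Measurable F) (hG : Measurable G) :
    scaleAvg (ρ.prod σ) (fun z : ℝ × ℝ => F z.1 * G z.2) =
      fun z => scaleAvg ρ F z.1 * scaleAvg σ G z.2 := by
  funext x
  simp only [scaleAvg, Prod.fst_mul, Prod.snd_mul]
  exact lintegral_prod_mul (hF.comp (measurable_const_mul _)).aemeasurable
    (hG.comp (measurable_const_mul _)).aemeasurable

theorem scaleAvg_prod_mul_iterate {ρ σ : Measure ℝ} [SFinite ρ] [SFinite σ] {F G : ℝ → ENNReal}
    (hF : Measurable F) (hG : Measurable G) (k : ℕ) :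
    (scaleAvg (ρ.prod σ))^[k] (fun z : ℝ × ℝ => F z.1 * G z.2) =
      fun z => (scaleAvg ρ)^[k] F z.1 * (scaleAvg σ)^[k] G z.2 := by
  induction k with
  | zero => rfl
  | succ k ih =>
    simp only [Function.iterate_succ_apply', ih]
    exact scaleAvg_prod_mul (measurable_scaleAvg_iterate _ hF k)
      (measurable_scaleAvg_iterate _ hG k)

/-- A comparison of the averages of `f` over two laws of nonnegative factors passes to products
of independent factors. -/
theorem scaleAvg_iterate_le_of_le {M : Type*} [CommMonoid M] [MeasurableSpace M]
    [MeasurableMul₂ M] {ρ σ : Measure M} [SFinite ρ] [SFinite σ] {S : Submonoid M}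
    (hρ : ∀ᵐ p ∂ρ, p ∈ S) (hσ : ∀ᵐ p ∂σ, p ∈ S) {f : M → ENNReal} (hf : Measurable f)
    (h : ∀ x ∈ S, scaleAvg ρ f x ≤ scaleAvg σ f x) (k : ℕ) :
    ∀ x ∈ S, (scaleAvg ρ)^[k] f x ≤ (scaleAvg σ)^[k] f x := by
  have hmono : ∀ (τ : Measure M), (∀ᵐ p ∂τ, p ∈ S) → ∀ {u v : M → ENNReal},
      (∀ x ∈ S, u x ≤ v x) → ∀ x ∈ S, scaleAvg τ u x ≤ scaleAvg τ v x := by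
    intro τ hτ u v huv x hx
    refine lintegral_mono_ae ?_
    filter_upwards [hτ] with p hp using huv _ (S.mul_mem hx hp)
  -- By commutativity a single factor can be exchanged under the average over the others.
  have hstep : ∀ j : ℕ, ∀ x ∈ S,
      scaleAvg ρ ((scaleAvg σ)^[j] f) x ≤ (scaleAvg σ)^[j + 1] f x := by
    intro j
    induction j with
    | zero => exact h
    | succ j ih =>
      intro x hx
      rw [Function.iterate_succ_apply', scaleAvg_comm ρ σ (measurable_scaleAvg_iterate σ hf j),
        Function.iterate_succ_apply' (scaleAvg σ) (j + 1)]
      exact hmono σ hσ ih x hx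
  induction k with
  | zero => exact fun x _ => le_rfl
  | succ k ih =>
    intro x hx
    rw [Function.iterate_succ_apply']
    exact (hmono ρ hρ ih x hx).trans (hstep k x hx)

/-! ### Decoupling -/

theorem ae_halfMeasure : ∀ᵐ v ∂halfMeasure, 0 < v ∧ v ≤ 1 / 2 := by
  have hm : MeasurableSet {v : ℝ | 0 < v ∧ v ≤ 1 / 2} := measurableSet_Ioc
  rw [halfMeasure, ae_map_iff (by fun_prop) hm, unitMeasure]
  filter_upwards [ae_restrict_mem measurableSet_Ioc] with z hz
  constructor <;> linarith [hz.1, hz.2]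

theorem halfMeasure_Ioo {s : ℝ} (hs : s ≤ 1 / 2) :
    halfMeasure (Set.Ioo 0 s) = ENNReal.ofReal (2 * s) := by
  rw [halfMeasure, Measure.map_apply (by fun_prop) measurableSet_Ioo, unitMeasure,
    Measure.restrict_apply ((by fun_prop : Measurable fun z : ℝ => z / 2) measurableSet_Ioo)]
  have : (fun z : ℝ => z / 2) ⁻¹' Set.Ioo 0 s ∩ Set.Ioc 0 1 = Set.Ioo 0 (2 * s) := by
    ext z
    simp only [Set.mem_inter_iff, Set.mem_preimage, Set.mem_Ioo, Set.mem_Ioc]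
    constructor
    · rintro ⟨⟨h1, h2⟩, _⟩
      constructor <;> linarith
    · rintro ⟨h1, h2⟩
      refine ⟨⟨?_, ?_⟩, ?_, ?_⟩ <;> linarith
  rw [this, Real.volume_Ioo, sub_zero]

/-- The joint law of the distances of `m x` and `n x` to the nearest integer. -/
def jointMeasure (m n : ℕ) : Measure (ℝ × ℝ) :=
  unitMeasure.map (fun x => (distInt (m * x), distInt (n * x)))

/-- The part of the majorant of `jointMeasure m n` that accounts for the dependence: a measure of
mass `gcd(m, n) / n` on the line through the origin of slope `n / m`. -/
def lineMeasure (m n : ℕ) : Measure (ℝ × ℝ) :=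
  ENNReal.ofReal (Nat.gcd m n / n) • halfMeasure.map (fun v => ((m : ℝ) / n * v, v))

/-- The majorant of `jointMeasure m n`, on rectangles with a corner at the origin. -/
def majorantMeasure (m n : ℕ) : Measure (ℝ × ℝ) :=
  halfMeasure.prod halfMeasure + lineMeasure m n

instance (m n : ℕ) : IsFiniteMeasure (jointMeasure m n) := by
  unfold jointMeasure; infer_instance

instance (m n : ℕ) : IsFiniteMeasure (lineMeasure m n) := by
  unfold lineMeasure
  exact Measure.smul_finite _ ENNReal.ofReal_ne_top

instance (m n : ℕ) : IsFiniteMeasure (majorantMeasure m n) := by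
  unfold majorantMeasure; infer_instance

/-- The indicator function of `(-∞, b)`. -/
def below (b : ℝ) : ℝ → ENNReal := (Set.Iio b).indicator fun _ => 1

theorem measurable_below (b : ℝ) : Measurable (below b) :=
  measurable_const.indicator measurableSet_Iio

theorem below_le_one (b x : ℝ) : below b x ≤ 1 :=
  Set.indicator_le_self' (fun _ _ => zero_le_one) x

theorem below_of_lt {b x : ℝ} (h : x < b) : below b x = 1 :=
  Set.indicator_of_mem (Set.mem_Iio.mpr h) _

theorem below_of_le {b x : ℝ} (h : b ≤ x) : below b x = 0 :=
  Set.indicator_of_notMem (fun h' => (Set.mem_Iio.mp h').not_ge h) _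

/-- The condition `x * p < a` on `p ∈ (0, 1/2]` defines an initial interval, up to its endpoint. -/
theorem exists_threshold {x : ℝ} (hx : 0 ≤ x) (a : ℝ) : ∃ s : ℝ, 0 ≤ s ∧ s ≤ 1 / 2 ∧
    (∀ p, 0 ≤ p → p ≤ 1 / 2 → x * p < a → p ≤ s) ∧ ∀ p, 0 < p → p < s → x * p < a := by
  rcases hx.eq_or_lt with rfl | hx
  · rcases le_or_gt a 0 with ha | ha
    · exact ⟨0, le_rfl, by norm_num, fun p _ _ h => by linarith, fun p h h' => by linarith⟩
    · exact ⟨1 / 2, by norm_num, le_rfl, fun p _ h _ => h, fun p _ _ => by linarith⟩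
  · refine ⟨max 0 (min (a / x) (1 / 2)), le_max_left _ _,
      max_le (by norm_num) (min_le_right _ _), fun p _ h1 h2 => ?_, fun p h1 h2 => ?_⟩
    · exact le_max_of_le_right (le_min ((le_div_iff₀ hx).mpr (by linarith)) h1)
    · rcases lt_max_iff.mp h2 with h | h
      · linarith
      · have := (lt_div_iff₀ hx).mp (lt_min_iff.mp h).1
        linarith

/-- The majorant dominates the joint law on the rectangles `x.1 * p.1 < a`, `x.2 * p.2 < b`: with
thresholds `s` and `t`, the line meets `(0, s) × (0, t)` in mass `2 gcd(m, n) min(s / m, t / n)`. -/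
theorem scaleAvg_jointMeasure_le {m n : ℕ} (hm : 0 < m) (hn : 0 < n) (a b : ℝ) {x : ℝ × ℝ}
    (hx : 0 ≤ x) :
    scaleAvg (jointMeasure m n) (fun z => below a z.1 * below b z.2) x ≤
      scaleAvg (majorantMeasure m n) (fun z => below a z.1 * below b z.2) x := by
  obtain ⟨s, hs0, hs1, hs, hs'⟩ := exists_threshold hx.1 a
  obtain ⟨t, ht0, ht1, ht, ht'⟩ := exists_threshold hx.2 b
  have hmR : (0 : ℝ) < m := by exact_mod_cast hm
  have hnR : (0 : ℝ) < n := by exact_mod_cast hn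
  have hfm : Measurable fun z : ℝ × ℝ => below a z.1 * below b z.2 :=
    ((measurable_below a).comp measurable_fst).mul ((measurable_below b).comp measurable_snd)
  set d : ℝ := (Nat.gcd m n : ℝ) with hd
  have hd0 : 0 ≤ d := by positivity
  have hupper : scaleAvg (jointMeasure m n) (fun z => below a z.1 * below b z.2) x ≤
      unitMeasure {y | distInt (m * y) ≤ s ∧ distInt (n * y) ≤ t} := by
    have hS : MeasurableSet {y : ℝ | distInt (m * y) ≤ s ∧ distInt (n * y) ≤ t} :=
      (measurableSet_le (f := fun y : ℝ => distInt (m * y)) (by fun_prop) measurable_const).inter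
        (measurableSet_le (f := fun y : ℝ => distInt (n * y)) (by fun_prop) measurable_const)
    have hjoint : Measurable fun y : ℝ => (distInt (m * y), distInt (n * y)) := by fun_prop
    refine (lintegral_map (hfm.comp (measurable_const_mul x)) hjoint).trans_le ?_
    rw [← lintegral_indicator_one hS]
    refine lintegral_mono fun y => ?_
    by_cases hy : y ∈ {y : ℝ | distInt (m * y) ≤ s ∧ distInt (n * y) ≤ t}
    · rw [Set.indicator_of_mem hy]
      exact mul_le_one' (below_le_one _ _) (below_le_one _ _)
    · rw [Set.indicator_of_notMem hy, nonpos_iff_eq_zero]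
      refine mul_eq_zero.mpr ?_
      by_contra! hcon
      refine hy ⟨hs _ (distInt_nonneg _) (distInt_le_half _) ?_,
        ht _ (distInt_nonneg _) (distInt_le_half _) ?_⟩
      · exact lt_of_not_ge fun h => hcon.1 (below_of_le h)
      · exact lt_of_not_ge fun h => hcon.2 (below_of_le h)
  have hbound : unitMeasure {y | distInt (m * y) ≤ s ∧ distInt (n * y) ≤ t} ≤
      ENNReal.ofReal (4 * s * t + 2 * d * min (s / m) (t / n)) := by
    rcases min_choice (s / m) (t / n) with h | h
    · rw [h]
      exact unitMeasure_distInt_le_and_le hm n hs1 ht0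
    · rw [h]
      have h1 := unitMeasure_distInt_le_and_le hn m ht1 hs0
      rw [Nat.gcd_comm n m, ← hd] at h1
      have h2 : {y : ℝ | distInt (m * y) ≤ s ∧ distInt (n * y) ≤ t} =
          {y : ℝ | distInt (n * y) ≤ t ∧ distInt (m * y) ≤ s} := by
        ext y
        exact and_comm
      rw [h2]
      refine h1.trans (le_of_eq ?_)
      congr 1
      ring
  have hlower : majorantMeasure m n (Set.Ioo 0 s ×ˢ Set.Ioo 0 t) ≤
      scaleAvg (majorantMeasure m n) (fun z => below a z.1 * below b z.2) x := by
    rw [scaleAvg, ← lintegral_indicator_one (measurableSet_Ioo.prod measurableSet_Ioo)]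
    refine lintegral_mono fun p => ?_
    by_cases hp : p ∈ Set.Ioo 0 s ×ˢ Set.Ioo 0 t
    · rw [Set.indicator_of_mem hp]
      have h1 : below a (x * p).1 = 1 := below_of_lt (hs' p.1 hp.1.1 hp.1.2)
      have h2 : below b (x * p).2 = 1 := below_of_lt (ht' p.2 hp.2.1 hp.2.2)
      rw [h1, h2, mul_one, Pi.one_apply]
    · rw [Set.indicator_of_notMem hp]
      exact zero_le
  refine hupper.trans (hbound.trans (le_trans ?_ hlower))
  have hline : (fun v : ℝ => ((m : ℝ) / n * v, v)) ⁻¹' (Set.Ioo 0 s ×ˢ Set.Ioo 0 t) =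
      Set.Ioo 0 (n * min (s / m) (t / n)) := by
    ext v
    simp only [Set.mem_preimage, Set.mem_prod, Set.mem_Ioo]
    have hv : v < n * min (s / m) (t / n) ↔ (m : ℝ) / n * v < s ∧ v < t := by
      rw [← mul_min_of_nonneg _ _ hnR.le |>.symm, lt_min_iff]
      have e1 : (n : ℝ) * (s / m) = s / (m / n) := by field_simp
      have e2 : (n : ℝ) * (t / n) = t := by field_simp
      rw [e1, e2, lt_div_iff₀ (by positivity), mul_comm v]
    rw [hv]
    constructor
    · rintro ⟨⟨_, h1⟩, h2, h3⟩
      exact ⟨h2, h1, h3⟩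
    · rintro ⟨h1, h2, h3⟩
      exact ⟨⟨by positivity, h2⟩, h1, h3⟩
  have hmin : n * min (s / m) (t / n) ≤ 1 / 2 := by
    have : n * min (s / m) (t / n) ≤ n * (t / n) := by gcongr; exact min_le_right _ _
    rw [mul_div_cancel₀ _ hnR.ne'] at this
    exact this.trans ht1
  have hmin0 : 0 ≤ min (s / m) (t / n) := le_min (by positivity) (by positivity)
  rw [majorantMeasure, Measure.add_apply, Measure.prod_prod, halfMeasure_Ioo hs1,
    halfMeasure_Ioo ht1, lineMeasure, Measure.smul_apply,
    Measure.map_apply (by fun_prop) (measurableSet_Ioo.prod measurableSet_Ioo), hline,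
    halfMeasure_Ioo hmin, smul_eq_mul, ← ENNReal.ofReal_mul (by positivity),
    ← ENNReal.ofReal_mul (by positivity), ← ENNReal.ofReal_add (by positivity) (by positivity)]
  apply ENNReal.ofReal_le_ofReal
  apply le_of_eq
  rw [← hd]
  field_simp
  ring

theorem ae_nonneg_jointMeasure (m n : ℕ) : ∀ᵐ p ∂jointMeasure m n, 0 ≤ p := by
  rw [jointMeasure, ae_map_iff (by fun_prop) measurableSet_Ici]
  exact Eventually.of_forall fun x => ⟨distInt_nonneg _, distInt_nonneg _⟩

theorem ae_nonneg_majorantMeasure (m n : ℕ) : ∀ᵐ p ∂majorantMeasure m n, 0 ≤ p := by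
  rw [majorantMeasure, ae_add_measure_iff]
  constructor
  · have h1 : ∀ᵐ p ∂halfMeasure.prod halfMeasure, 0 < p.1 :=
      Measure.quasiMeasurePreserving_fst.ae (ae_halfMeasure.mono fun v hv => hv.1)
    have h2 : ∀ᵐ p ∂halfMeasure.prod halfMeasure, 0 < p.2 :=
      Measure.quasiMeasurePreserving_snd.ae (ae_halfMeasure.mono fun v hv => hv.1)
    filter_upwards [h1, h2] with p hp1 hp2 using ⟨hp1.le, hp2.le⟩
  · rw [lineMeasure]
    refine Measure.ae_smul_measure ?_ _
    rw [ae_map_iff (by fun_prop) measurableSet_Ici]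
    filter_upwards [ae_halfMeasure] with v hv
    have := hv.1.le
    exact ⟨mul_nonneg (by positivity) this, this⟩

/-- The submonoid of pairs of nonnegative reals. -/
def nonnegPairs : Submonoid (ℝ × ℝ) where
  carrier := Set.Ici 0
  mul_mem' ha hb := ⟨mul_nonneg ha.1 hb.1, mul_nonneg ha.2 hb.2⟩
  one_mem' := ⟨zero_le_one, zero_le_one⟩

theorem map_snd_lineMeasure (m n : ℕ) :
    (lineMeasure m n).map Prod.snd = ENNReal.ofReal (Nat.gcd m n / n) • halfMeasure := by
  rw [lineMeasure, Measure.map_smul, Measure.map_map measurable_snd (by fun_prop)]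
  congr 1
  exact Measure.map_id

/-- The averages of a function `f ≤ g ∘ snd` over products of `k` factors from the majorant:
the terms with at most one factor from the line are kept, and in the others every factor from the
line contributes at most its mass `gcd(m, n) / n`. -/
theorem scaleAvg_majorantMeasure_iterate_le {m n : ℕ} (hn : 0 < n) {f : ℝ × ℝ → ENNReal}
    (hf : Measurable f) {g : ℝ → ENNReal} (hg : Measurable g) (hfg : f ≤ g ∘ Prod.snd) (k : ℕ) :
    (scaleAvg (majorantMeasure m n))^[k] f ≤ fun x =>
      (scaleAvg (halfMeasure.prod halfMeasure))^[k] f x +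
      k * scaleAvg (lineMeasure m n) ((scaleAvg (halfMeasure.prod halfMeasure))^[k - 1] f) x +
      3 ^ k * ENNReal.ofReal (Nat.gcd m n / n) ^ 2 * (scaleAvg halfMeasure)^[k] g x.2 := by
  set π := halfMeasure.prod halfMeasure with hπ
  set D := lineMeasure m n with hD
  set e := ENNReal.ofReal (Nat.gcd m n / n) with he
  have he1 : e ≤ 1 := by
    rw [he, ← ENNReal.ofReal_one]
    apply ENNReal.ofReal_le_ofReal
    exact div_le_one_of_le₀ (by exact_mod_cast Nat.gcd_le_right m hn) (by positivity)
  have hπsnd : ∀ h : ℝ → ENNReal, Measurable h →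
      scaleAvg π (h ∘ Prod.snd) = scaleAvg halfMeasure h ∘ Prod.snd := by
    intro h hh
    rw [scaleAvg_comp_snd π hh, hπ, ← Measure.snd, Measure.snd_prod]
  have hDsnd : ∀ h : ℝ → ENNReal, Measurable h →
      scaleAvg D (h ∘ Prod.snd) = fun x => e * scaleAvg halfMeasure h x.2 := by
    intro h hh
    rw [scaleAvg_comp_snd D hh, map_snd_lineMeasure, scaleAvg_smul_measure]
    rfl
  have hgm := measurable_scaleAvg_iterate halfMeasure hg
  have hπle : ∀ j, (scaleAvg π)^[j] f ≤ (scaleAvg halfMeasure)^[j] g ∘ Prod.snd := by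
    intro j
    induction j with
    | zero => exact hfg
    | succ j ih =>
      simp only [Function.iterate_succ_apply']
      rw [← hπsnd _ (hgm j)]
      exact scaleAvg_mono π ih
  induction k with
  | zero =>
    intro x
    simp only [Function.iterate_zero, id, Nat.cast_zero, zero_mul, add_zero]
    exact le_self_add
  | succ k ih =>
    have hfm := measurable_scaleAvg_iterate π hf
    have hlast : Measurable fun x : ℝ × ℝ => (scaleAvg halfMeasure)^[k] g x.2 :=
      (hgm k).comp measurable_snd
    have hDf := measurable_scaleAvg D (hfm (k - 1))
    have hcomm : ∀ x, (k : ENNReal) * scaleAvg π (scaleAvg D ((scaleAvg π)^[k - 1] f)) x =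
        k * scaleAvg D ((scaleAvg π)^[k] f) x := by
      intro x
      cases k with
      | zero => simp
      | succ j =>
        rw [Nat.add_sub_cancel, scaleAvg_comm π D (hfm j), Function.iterate_succ_apply']
    -- Two factors from the line: each costs the mass `e` in the second coordinate.
    have hDD : ∀ x, (k : ENNReal) * scaleAvg D (scaleAvg D ((scaleAvg π)^[k - 1] f)) x ≤
        k * (e ^ 2 * (scaleAvg halfMeasure)^[k + 1] g x.2) := by
      intro x
      cases k with
      | zero => simp
      | succ j =>
        gcongr
        refine (scaleAvg_mono D (scaleAvg_mono D (hπle j)) x).trans (le_of_eq ?_)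
        rw [hDsnd _ (hgm j)]
        have := congrFun (scaleAvg_const_smul D ((hgm (j + 1)).comp measurable_snd) e) x
        rw [Function.iterate_succ_apply'] at this
        refine this.trans ?_
        rw [hDsnd _ (measurable_scaleAvg _ (hgm j)), Function.iterate_succ_apply',
          Function.iterate_succ_apply', sq, mul_assoc]
    have hexp : ∀ (τ : Measure (ℝ × ℝ)) (x : ℝ × ℝ), scaleAvg τ (fun x =>
        (scaleAvg π)^[k] f x + k * scaleAvg D ((scaleAvg π)^[k - 1] f) x +
          3 ^ k * e ^ 2 * (scaleAvg halfMeasure)^[k] g x.2) x =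
        scaleAvg τ ((scaleAvg π)^[k] f) x +
          k * scaleAvg τ (scaleAvg D ((scaleAvg π)^[k - 1] f)) x +
          3 ^ k * e ^ 2 * scaleAvg τ ((scaleAvg halfMeasure)^[k] g ∘ Prod.snd) x := by
      intro τ x
      have h1 := scaleAvg_add τ (f := fun x => (scaleAvg π)^[k] f x +
        k * scaleAvg D ((scaleAvg π)^[k - 1] f) x)
        (g := fun x => 3 ^ k * e ^ 2 * (scaleAvg halfMeasure)^[k] g x.2)
        ((hfm k).add (hDf.const_mul _))
      have h2 := scaleAvg_add τ (f := (scaleAvg π)^[k] f)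
        (g := fun x => k * scaleAvg D ((scaleAvg π)^[k - 1] f) x) (hfm k)
      refine (congrFun h1 x).trans ?_
      refine congrArg₂ (· + ·)
        ((congrFun h2 x).trans (congrArg (scaleAvg τ ((scaleAvg π)^[k] f) x + ·) ?_)) ?_
      · exact congrFun (scaleAvg_const_smul τ hDf _) x
      · exact congrFun (scaleAvg_const_smul τ hlast _) x
    intro x
    rw [Function.iterate_succ_apply']
    refine (scaleAvg_mono _ ih x).trans ?_
    rw [majorantMeasure, scaleAvg_add_measure, Pi.add_apply, ← hπ, ← hD, hexp, hexp, hcomm,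
      hπsnd _ (hgm k), hDsnd _ (hgm k), ← Function.iterate_succ_apply' (scaleAvg π),
      Function.comp_apply, ← Function.iterate_succ_apply' (scaleAvg halfMeasure),
      Nat.add_sub_cancel]
    set G := (scaleAvg halfMeasure)^[k + 1] g x.2 with hG
    set A := (scaleAvg π)^[k + 1] f x
    set B := scaleAvg D ((scaleAvg π)^[k] f) x
    have hk3 : (k : ENNReal) ≤ 3 ^ k := by
      exact_mod_cast (Nat.lt_pow_self (by norm_num : 1 < 3)).le
    have hDD' := (hDD x).trans (mul_le_mul_left hk3 _)
    calc A + k * B + 3 ^ k * e ^ 2 * G +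
          (B + k * scaleAvg D (scaleAvg D ((scaleAvg π)^[k - 1] f)) x + 3 ^ k * e ^ 2 * (e * G))
        ≤ A + k * B + 3 ^ k * e ^ 2 * G +
          (B + 3 ^ k * (e ^ 2 * G) + 3 ^ k * e ^ 2 * (1 * G)) := by
          gcongr
      _ = A + ((k + 1 : ℕ) : ENNReal) * B + 3 ^ (k + 1) * e ^ 2 * G := by
          push_cast
          ring

/-! ### Products of uniform variables -/

/-- The probability that a product of `k` independent uniform variables on `(0, 1]` is less
than `t`, for `t ≥ 0`. -/
def hyperVol (k : ℕ) (t : ℝ) : ℝ :=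
  if t ≤ 1 then t * ∑ j ∈ Finset.range k, (-Real.log t) ^ j / (j.factorial : ℝ) else 1

theorem hyperVol_of_le {k : ℕ} {t : ℝ} (ht : t ≤ 1) :
    hyperVol k t = t * ∑ j ∈ Finset.range k, (-Real.log t) ^ j / (j.factorial : ℝ) := if_pos ht

theorem hyperVol_of_gt {k : ℕ} {t : ℝ} (ht : 1 < t) : hyperVol k t = 1 := if_neg ht.not_ge

theorem hyperVol_zero_right (k : ℕ) : hyperVol k 0 = 0 := by
  rw [hyperVol_of_le zero_le_one, zero_mul]

theorem hyperVol_nonneg (k : ℕ) {t : ℝ} (ht : 0 ≤ t) : 0 ≤ hyperVol k t := by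
  rcases le_or_gt t 1 with h | h
  · rw [hyperVol_of_le h]
    have := Real.log_nonpos ht h
    exact mul_nonneg ht (Finset.sum_nonneg fun j _ =>
      div_nonneg (pow_nonneg (by linarith) j) (by positivity))
  · rw [hyperVol_of_gt h]
    exact zero_le_one

@[fun_prop]
theorem measurable_hyperVol (k : ℕ) : Measurable (hyperVol k) := by
  refine Measurable.ite measurableSet_Iic ?_ measurable_const
  fun_prop

theorem lintegral_hyperVol_of_le (k : ℕ) {t : ℝ} (ht0 : 0 < t) (ht1 : t ≤ 1) :
    ∫⁻ z in Set.Ioc t 1, ENNReal.ofReal (hyperVol k (t / z)) =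
      ENNReal.ofReal (t * ∑ j ∈ Finset.range k,
        (-Real.log t) ^ (j + 1) / ((j + 1).factorial : ℝ)) := by
  set F : ℝ → ℝ := fun z => t * ∑ j ∈ Finset.range k,
    (Real.log z - Real.log t) ^ (j + 1) / ((j + 1).factorial : ℝ) with hF
  set F' : ℝ → ℝ := fun z => t / z * ∑ j ∈ Finset.range k,
    (Real.log z - Real.log t) ^ j / (j.factorial : ℝ) with hF'
  have hEq : ∀ z ∈ Set.Ioc t 1, hyperVol k (t / z) = F' z := by
    intro z hz
    have hz0 : 0 < z := ht0.trans hz.1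
    rw [hyperVol_of_le ((div_le_one hz0).mpr hz.1.le), Real.log_div ht0.ne' hz0.ne', neg_sub]
  have hderiv : ∀ z ∈ Set.uIcc t 1, HasDerivAt F (F' z) z := by
    intro z hz
    rw [Set.uIcc_of_le ht1] at hz
    have hz0 : 0 < z := ht0.trans_le hz.1
    have h1 : ∀ j ∈ Finset.range k, HasDerivAt
        (fun z => (Real.log z - Real.log t) ^ (j + 1) / ((j + 1).factorial : ℝ))
        ((Real.log z - Real.log t) ^ j / (j.factorial : ℝ) * z⁻¹) z := by
      intro j _
      have h2 := (((Real.hasDerivAt_log hz0.ne').sub_const (Real.log t)).pow (j + 1)).div_const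
        ((j + 1).factorial : ℝ)
      refine h2.congr_deriv ?_
      rw [Nat.factorial_succ]
      push_cast
      have : (j.factorial : ℝ) ≠ 0 := by positivity
      have : (j : ℝ) + 1 ≠ 0 := by positivity
      field_simp
    have h3 := (HasDerivAt.fun_sum h1).const_mul t
    refine h3.congr_deriv ?_
    simp only [hF']
    rw [← Finset.sum_mul, div_eq_mul_inv]
    ring
  have hcont : ContinuousOn F' (Set.uIcc t 1) := by
    rw [Set.uIcc_of_le ht1]
    have hne : ∀ z ∈ Set.Icc t 1, z ≠ 0 := fun z hz => (ht0.trans_le hz.1).ne'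
    refine (continuousOn_const.div continuousOn_id hne).mul ?_
    refine continuousOn_finsetSum _ fun j _ => ?_
    exact (((Real.continuousOn_log.mono fun z hz => hne z hz).sub continuousOn_const).pow
      j).div_const _
  have hint := intervalIntegral.integral_eq_sub_of_hasDerivAt hderiv hcont.intervalIntegrable
  have hint' : IntegrableOn F' (Set.Ioc t 1) :=
    (intervalIntegrable_iff_integrableOn_Ioc_of_le ht1).mp hcont.intervalIntegrable
  rw [setLIntegral_congr_fun measurableSet_Ioc fun z hz => by
    exact congrArg ENNReal.ofReal (hEq z hz)]
  rw [← ofReal_integral_eq_lintegral_ofReal hint', ← intervalIntegral.integral_of_le ht1, hint]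
  · simp [hF]
  · filter_upwards [ae_restrict_mem measurableSet_Ioc] with z hz
    rw [← hEq z hz]
    exact hyperVol_nonneg k (div_nonneg ht0.le (ht0.trans hz.1).le)

/-- Adding one uniform factor to the product. -/
theorem lintegral_hyperVol (k : ℕ) {t : ℝ} (ht : 0 ≤ t) :
    ∫⁻ z, ENNReal.ofReal (hyperVol k (t / z)) ∂unitMeasure =
      ENNReal.ofReal (hyperVol (k + 1) t) := by
  rcases ht.eq_or_lt with rfl | ht0
  · simp [hyperVol_zero_right]
  rcases lt_or_ge 1 t with ht1 | ht1
  · rw [hyperVol_of_gt ht1, unitMeasure, setLIntegral_congr_fun (g := fun _ => 1) measurableSet_Ioc]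
    · simp
    · intro z hz
      have h : 1 < t / z := (one_lt_div hz.1).mpr (hz.2.trans_lt ht1)
      simp [hyperVol_of_gt h]
  · rw [unitMeasure, ← Set.Ioc_union_Ioc_eq_Ioc ht0.le ht1,
      lintegral_union measurableSet_Ioc (Set.Ioc_disjoint_Ioc_of_le le_rfl),
      lintegral_hyperVol_of_le k ht0 ht1, setLIntegral_congr Ioo_ae_eq_Ioc.symm,
      setLIntegral_congr_fun (g := fun _ => 1) measurableSet_Ioo]
    · have hlog : 0 ≤ -Real.log t := by linarith [Real.log_nonpos ht ht1]
      rw [setLIntegral_one, Real.volume_Ioo, sub_zero, ← ENNReal.ofReal_add ht0.le (by positivity),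
        hyperVol_of_le ht1, Finset.sum_range_succ']
      congr 1
      simp
      ring
    · intro z hz
      simp [hyperVol_of_gt ((one_lt_div hz.1).mpr hz.2)]

theorem lintegral_halfMeasure {f : ℝ → ENNReal} (hf : Measurable f) :
    ∫⁻ v, f v ∂halfMeasure = ∫⁻ z, f (z / 2) ∂unitMeasure :=
  lintegral_map hf (by fun_prop)

theorem ae_unitMeasure : ∀ᵐ z ∂unitMeasure, 0 < z ∧ z ≤ 1 :=
  ae_restrict_mem measurableSet_Ioc

theorem scaleAvg_halfMeasure_iterate_below (k : ℕ) {b : ℝ} (hb : 0 ≤ b) {y : ℝ} (hy : 0 < y) :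
    (scaleAvg halfMeasure)^[k] (below b) y = ENNReal.ofReal (hyperVol k (2 ^ k * b / y)) := by
  induction k generalizing y with
  | zero =>
    rw [pow_zero, one_mul, Function.iterate_zero, id]
    rcases lt_or_ge y b with h | h
    · rw [below_of_lt h, hyperVol_of_gt ((one_lt_div hy).mpr h), ENNReal.ofReal_one]
    · rw [below_of_le h, hyperVol_of_le ((div_le_one hy).mpr h)]
      simp
  | succ k ih =>
    have hm := measurable_scaleAvg_iterate halfMeasure (measurable_below b) k
    rw [Function.iterate_succ_apply',
      ← lintegral_hyperVol k (by positivity : 0 ≤ 2 ^ (k + 1) * b / y)]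
    refine (lintegral_halfMeasure (hm.comp (measurable_const_mul y))).trans ?_
    refine lintegral_congr_ae ?_
    filter_upwards [ae_unitMeasure] with z hz
    have := hz.1
    rw [Function.comp_apply, ih (by positivity)]
    congr 2
    field_simp
    ring

theorem hyperVol_le_one (k : ℕ) {t : ℝ} (ht : 0 ≤ t) : hyperVol k t ≤ 1 := by
  have h := scaleAvg_halfMeasure_iterate_below k (b := t / 2 ^ k) (by positivity) one_pos
  have h1 : (scaleAvg halfMeasure)^[k] (below (t / 2 ^ k)) 1 ≤ 1 := by
    have : ∀ j x, (scaleAvg halfMeasure)^[j] (below (t / 2 ^ k)) x ≤ 1 := by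
      intro j
      induction j with
      | zero => exact fun x => below_le_one _ x
      | succ j ih =>
        intro x
        rw [Function.iterate_succ_apply']
        exact (lintegral_mono fun p => ih (x * p)).trans (by simp)
    exact this k 1
  rw [h, div_one, mul_div_cancel₀ _ (by positivity)] at h1
  simpa using h1

/-- `hyperVol` is linear up to logarithms, which are absorbed by
`(L / 8) ^ j / j! ≤ exp (L / 8)` with `L = -log t`. -/
theorem hyperVol_le_rpow (k : ℕ) {t q : ℝ} (ht : 0 ≤ t) (hq0 : 0 < q) (hq : q ≤ 7 / 8) :
    hyperVol k t ≤ 8 ^ k * t ^ q := by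
  rcases ht.eq_or_lt with rfl | ht0
  · rw [hyperVol_zero_right, Real.zero_rpow hq0.ne', mul_zero]
  have h8 : (1 : ℝ) ≤ 8 ^ k := one_le_pow₀ (by norm_num)
  rcases lt_or_ge 1 t with ht1 | ht1
  · rw [hyperVol_of_gt ht1]
    exact one_le_mul_of_one_le_of_one_le h8 (Real.one_le_rpow ht1.le hq0.le)
  · rw [hyperVol_of_le ht1]
    set L := -Real.log t with hL
    have hL0 : 0 ≤ L := by linarith [Real.log_nonpos ht ht1]
    have hexp : t * Real.exp (L / 8) = t ^ (7 / 8 : ℝ) := by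
      rw [Real.rpow_def_of_pos ht0]
      nth_rewrite 1 [← Real.exp_log ht0]
      rw [← Real.exp_add]
      congr 1
      rw [hL]
      ring
    have hterm : ∀ j ∈ Finset.range k, L ^ j / (j.factorial : ℝ) ≤ 8 ^ j * Real.exp (L / 8) := by
      intro j _
      have := Real.pow_div_factorial_le_exp (L / 8) (by positivity) j
      calc L ^ j / (j.factorial : ℝ) = 8 ^ j * ((L / 8) ^ j / (j.factorial : ℝ)) := by
            rw [div_pow]
            field_simp
        _ ≤ _ := by gcongr
    have hgeom : ∑ j ∈ Finset.range k, (8 : ℝ) ^ j ≤ 8 ^ k := by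
      have := geom_sum_eq (by norm_num : (8 : ℝ) ≠ 1) k
      rw [this, div_le_iff₀ (by norm_num)]
      linarith
    calc t * ∑ j ∈ Finset.range k, L ^ j / (j.factorial : ℝ)
        ≤ t * ∑ j ∈ Finset.range k, 8 ^ j * Real.exp (L / 8) := by
          gcongr with j hj
          exact hterm j hj
      _ = (∑ j ∈ Finset.range k, (8 : ℝ) ^ j) * (t * Real.exp (L / 8)) := by
          rw [← Finset.sum_mul]
          ring
      _ ≤ 8 ^ k * t ^ (7 / 8 : ℝ) := by
          rw [hexp]
          gcongr
      _ ≤ 8 ^ k * t ^ q := by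
          gcongr 8 ^ k * ?_
          exact Real.rpow_le_rpow_of_exponent_ge ht0 ht1 hq

theorem lintegral_Ioc_rpow {B p : ℝ} (hB : 0 ≤ B) (hp : -1 < p) :
    ∫⁻ z in Set.Ioc 0 B, ENNReal.ofReal (z ^ p) = ENNReal.ofReal (B ^ (p + 1) / (p + 1)) := by
  have hi : IntegrableOn (fun z : ℝ => z ^ p) (Set.Ioc 0 B) :=
    (intervalIntegrable_iff_integrableOn_Ioc_of_le hB).mp
      (intervalIntegral.intervalIntegrable_rpow' hp)
  rw [← ofReal_integral_eq_lintegral_ofReal hi, ← intervalIntegral.integral_of_le hB,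
    integral_rpow (Or.inl hp), Real.zero_rpow (by linarith), sub_zero]
  filter_upwards [ae_restrict_mem measurableSet_Ioc] with z hz
  exact Real.rpow_nonneg hz.1.le p

theorem lintegral_Ioi_rpow {B p : ℝ} (hB : 0 < B) (hp : p < -1) :
    ∫⁻ z in Set.Ioi B, ENNReal.ofReal (z ^ p) = ENNReal.ofReal (-B ^ (p + 1) / (p + 1)) := by
  rw [← ofReal_integral_eq_lintegral_ofReal (integrableOn_Ioi_rpow_of_lt hp hB),
    integral_Ioi_rpow_of_lt hp hB]
  filter_upwards [ae_restrict_mem measurableSet_Ioi] with z hz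
  exact Real.rpow_nonneg (hB.trans hz).le p

/-- On `z ≤ B` the second factor is bounded by a power of exponent `1 / 2`, on `z > B` by a power
of exponent `7 / 8`; together with the exponent `1 / 5` for the first factor the total exponent is
on either side of one. -/
theorem lintegral_hyperVol_mul_le (r : ℕ) {A B : ℝ} (hA : 0 ≤ A) (hB : 0 ≤ B) :
    ∫⁻ z, ENNReal.ofReal (hyperVol r (A / z)) * ENNReal.ofReal (hyperVol r (B / z)) ∂unitMeasure ≤
      ENNReal.ofReal (17 * 64 ^ r * (A ^ (1 / 5 : ℝ) * B ^ (4 / 5 : ℝ))) := by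
  rcases hB.eq_or_lt with rfl | hB0
  · simp [hyperVol_zero_right]
  have hpt : ∀ (q : ℝ), 0 < q → q ≤ 7 / 8 → ∀ z : ℝ, 0 < z →
      ENNReal.ofReal (hyperVol r (A / z)) * ENNReal.ofReal (hyperVol r (B / z)) ≤
        ENNReal.ofReal (64 ^ r * (A ^ (1 / 5 : ℝ) * B ^ q)) *
          ENNReal.ofReal (z ^ (-(1 / 5) - q)) := by
    intro q hq0 hq z hz
    have hAz : 0 ≤ A / z := by positivity
    have hBz : 0 ≤ B / z := by positivity
    rw [← ENNReal.ofReal_mul (hyperVol_nonneg r hAz), ← ENNReal.ofReal_mul (by positivity)]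
    apply ENNReal.ofReal_le_ofReal
    refine (mul_le_mul (hyperVol_le_rpow r hAz (by norm_num) (by norm_num : (1 / 5 : ℝ) ≤ 7 / 8))
      (hyperVol_le_rpow r hBz hq0 hq) (hyperVol_nonneg r hBz) (by positivity)).trans (le_of_eq ?_)
    rw [Real.div_rpow hA hz.le, Real.div_rpow hB hz.le, Real.rpow_sub hz, Real.rpow_neg hz.le,
      show (64 : ℝ) = 8 * 8 by norm_num, mul_pow]
    field_simp
  have hsub : unitMeasure ≤ volume.restrict (Set.Ioc 0 B) + volume.restrict (Set.Ioi B) := by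
    rw [unitMeasure, ← Measure.restrict_union (Set.Ioc_disjoint_Ioi le_rfl) measurableSet_Ioi,
      Set.Ioc_union_Ioi_eq_Ioi hB]
    exact Measure.restrict_mono_set _ fun z hz => hz.1
  refine (lintegral_mono' hsub le_rfl).trans ?_
  rw [lintegral_add_measure]
  have h1 : ∫⁻ z in Set.Ioc 0 B, ENNReal.ofReal (hyperVol r (A / z)) *
      ENNReal.ofReal (hyperVol r (B / z)) ≤
      ENNReal.ofReal (64 ^ r * (A ^ (1 / 5 : ℝ) * B ^ (1 / 2 : ℝ))) *
        ENNReal.ofReal (B ^ (3 / 10 : ℝ) / (3 / 10)) := by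
    refine (setLIntegral_mono' measurableSet_Ioc fun z hz =>
      hpt (1 / 2) (by norm_num) (by norm_num) z hz.1).trans ?_
    rw [lintegral_const_mul _ (by fun_prop), lintegral_Ioc_rpow hB (by norm_num)]
    norm_num
  have h2 : ∫⁻ z in Set.Ioi B, ENNReal.ofReal (hyperVol r (A / z)) *
      ENNReal.ofReal (hyperVol r (B / z)) ≤
      ENNReal.ofReal (64 ^ r * (A ^ (1 / 5 : ℝ) * B ^ (7 / 8 : ℝ))) *
        ENNReal.ofReal (B ^ (-(3 / 40) : ℝ) / (3 / 40)) := by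
    refine (setLIntegral_mono' measurableSet_Ioi fun z hz =>
      hpt (7 / 8) (by norm_num) le_rfl z (hB0.trans hz)).trans ?_
    rw [lintegral_const_mul _ (by fun_prop), lintegral_Ioi_rpow hB0 (by norm_num)]
    norm_num [div_neg, neg_div]
  refine (add_le_add h1 h2).trans ?_
  rw [← ENNReal.ofReal_mul (by positivity), ← ENNReal.ofReal_mul (by positivity),
    ← ENNReal.ofReal_add (by positivity) (by positivity)]
  apply ENNReal.ofReal_le_ofReal
  have e1 : B ^ (1 / 2 : ℝ) * B ^ (3 / 10 : ℝ) = B ^ (4 / 5 : ℝ) := by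
    rw [← Real.rpow_add hB0]
    norm_num
  have e2 : B ^ (7 / 8 : ℝ) * B ^ (-(3 / 40) : ℝ) = B ^ (4 / 5 : ℝ) := by
    rw [← Real.rpow_add hB0]
    norm_num
  have e3 : 0 ≤ 64 ^ r * (A ^ (1 / 5 : ℝ) * B ^ (4 / 5 : ℝ)) := by positivity
  calc 64 ^ r * (A ^ (1 / 5 : ℝ) * B ^ (1 / 2 : ℝ)) * (B ^ (3 / 10 : ℝ) / (3 / 10)) +
        64 ^ r * (A ^ (1 / 5 : ℝ) * B ^ (7 / 8 : ℝ)) * (B ^ (-(3 / 40) : ℝ) / (3 / 40))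
      = 64 ^ r * (A ^ (1 / 5 : ℝ) * (B ^ (1 / 2 : ℝ) * B ^ (3 / 10 : ℝ))) / (3 / 10) +
        64 ^ r * (A ^ (1 / 5 : ℝ) * (B ^ (7 / 8 : ℝ) * B ^ (-(3 / 40) : ℝ))) / (3 / 40) := by
        ring
    _ ≤ 17 * 64 ^ r * (A ^ (1 / 5 : ℝ) * B ^ (4 / 5 : ℝ)) := by
        -- `10 / 3 + 40 / 3 = 50 / 3 ≤ 17`
        rw [e1, e2]
        linarith

/-! ### The events and their correlations -/

/-- The law of a uniform point of the unit cube `(0, 1]ᵏ`. -/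
def cubeMeasure (k : ℕ) : Measure (Fin k → ℝ) := Measure.pi fun _ => unitMeasure

instance (k : ℕ) : IsProbabilityMeasure (cubeMeasure k) := by
  unfold cubeMeasure; infer_instance

/-- The set of `α` with `‖n α₁‖ ⋯ ‖n α_k‖ < b`. -/
def hyperSet (k n : ℕ) (b : ℝ) : Set (Fin k → ℝ) := {α | ∏ i, distInt (n * α i) < b}

theorem measurableSet_hyperSet (k n : ℕ) (b : ℝ) : MeasurableSet (hyperSet k n b) :=
  measurableSet_lt (Finset.measurable_prod _ fun i _ => by fun_prop) measurable_const

theorem cubeMeasure_hyperSet {k n : ℕ} (hn : 0 < n) {b : ℝ} (hb : 0 ≤ b) :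
    cubeMeasure k (hyperSet k n b) = ENNReal.ofReal (hyperVol k (2 ^ k * b)) := by
  have h := lintegral_pi_mul_prod_eq_iterate unitMeasure (u := fun x => distInt (n * x))
    (by fun_prop) (measurable_below b) k 1
  rw [map_distInt hn, scaleAvg_halfMeasure_iterate_below k hb one_pos, div_one] at h
  rw [← h, ← lintegral_indicator_one (measurableSet_hyperSet k n b), cubeMeasure]
  refine lintegral_congr fun α => ?_
  rw [one_mul]
  by_cases hα : α ∈ hyperSet k n b
  · rw [Set.indicator_of_mem hα, below_of_lt hα, Pi.one_apply]
  · rw [Set.indicator_of_notMem hα, below_of_le (not_lt.mp hα)]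

theorem hyperVol_mul_pow_le_of_le (k : ℕ) {a b : ℝ} (ha : 0 ≤ a) (hab : a ≤ b) :
    hyperVol k (2 ^ k * a) ≤ hyperVol k (2 ^ k * b) := by
  have h : cubeMeasure k (hyperSet k 1 a) ≤ cubeMeasure k (hyperSet k 1 b) :=
    measure_mono fun α hα => lt_of_lt_of_le hα hab
  rw [cubeMeasure_hyperSet one_pos ha, cubeMeasure_hyperSet one_pos (ha.trans hab)] at h
  exact (ENNReal.ofReal_le_ofReal_iff (hyperVol_nonneg k (by
    have := ha.trans hab
    positivity))).mp h

/-- The weights in the arithmetic-geometric mean inequality are chosen so that, with `w = n / m`,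
the first term is summable over the multiples `m ≤ n` and the second over the multiples `n ≥ m` of a
common divisor, in both cases without a logarithm. -/
theorem rpow_mul_rpow_le {a b w : ℝ} (ha : 0 ≤ a) (hb : 0 ≤ b) (hw : 0 < w) :
    (a * w) ^ (1 / 5 : ℝ) * b ^ (4 / 5 : ℝ) ≤ b * √w + a / w := by
  have h := Real.geom_mean_le_arith_mean2_weighted (w₁ := 1 / 5) (w₂ := 4 / 5)
    (p₁ := a / w) (p₂ := b * √w) (by norm_num) (by norm_num) (by positivity) (by positivity)
    (by norm_num)
  have e : (a / w) ^ (1 / 5 : ℝ) * (b * √w) ^ (4 / 5 : ℝ) =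
      (a * w) ^ (1 / 5 : ℝ) * b ^ (4 / 5 : ℝ) := by
    rw [Real.div_rpow ha hw.le, Real.mul_rpow hb (Real.sqrt_nonneg w), Real.mul_rpow ha hw.le,
      Real.sqrt_eq_rpow, ← Real.rpow_mul hw.le]
    have : w ^ (1 / 2 * (4 / 5) : ℝ) = w ^ (1 / 5 : ℝ) * w ^ (1 / 5 : ℝ) := by
      rw [← Real.rpow_add hw]
      norm_num
    rw [this]
    have : w ^ (1 / 5 : ℝ) ≠ 0 := (Real.rpow_pos_of_pos hw _).ne'
    field_simp
  rw [← e]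
  refine h.trans ?_
  have h1 : 0 ≤ a / w := by positivity
  have h2 : 0 ≤ b * √w := by positivity
  linarith

/-- The contribution of exactly one factor from the line. -/
theorem scaleAvg_lineMeasure_le {k m n : ℕ} (hk : 0 < k) (hm : 0 < m) (hn : 0 < n) {a b : ℝ}
    (ha : 0 ≤ a) (hb : 0 ≤ b) :
    scaleAvg (lineMeasure m n) ((scaleAvg (halfMeasure.prod halfMeasure))^[k - 1]
      (fun z : ℝ × ℝ => below a z.1 * below b z.2)) 1 ≤
      ENNReal.ofReal (17 * 64 ^ k * 2 ^ k *
        (Nat.gcd m n / n * (b * √(n / m) + a * (m / n)))) := by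
  obtain ⟨r, rfl⟩ : ∃ r, k = r + 1 := ⟨k - 1, by omega⟩
  have hmR : (0 : ℝ) < m := by exact_mod_cast hm
  have hnR : (0 : ℝ) < n := by exact_mod_cast hn
  have hFa := measurable_scaleAvg_iterate halfMeasure (measurable_below a) r
  have hFb := measurable_scaleAvg_iterate halfMeasure (measurable_below b) r
  rw [Nat.add_sub_cancel, scaleAvg_prod_mul_iterate (measurable_below a) (measurable_below b),
    lineMeasure, scaleAvg_smul_measure]
  have hprod : Measurable fun z : ℝ × ℝ => (scaleAvg halfMeasure)^[r] (below a) z.1 *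
      (scaleAvg halfMeasure)^[r] (below b) z.2 :=
    (hFa.comp measurable_fst).mul (hFb.comp measurable_snd)
  have hline : Measurable fun v : ℝ => ((m : ℝ) / n * v, v) := by fun_prop
  simp only [scaleAvg, one_mul]
  change _ * ∫⁻ p : ℝ × ℝ, (scaleAvg halfMeasure)^[r] (below a) p.1 *
      (scaleAvg halfMeasure)^[r] (below b) p.2 ∂_ ≤ _
  have hmap := (lintegral_map hprod hline).trans (lintegral_halfMeasure (hprod.comp hline))
  simp only at hmap
  rw [hmap]
  have hcongr : ∫⁻ z, (scaleAvg halfMeasure)^[r] (below a) ((m : ℝ) / n * (z / 2)) *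
        (scaleAvg halfMeasure)^[r] (below b) (z / 2) ∂unitMeasure =
      ∫⁻ z, ENNReal.ofReal (hyperVol r (2 ^ (r + 1) * (a * (n / m)) / z)) *
        ENNReal.ofReal (hyperVol r (2 ^ (r + 1) * b / z)) ∂unitMeasure := by
    refine lintegral_congr_ae ?_
    filter_upwards [ae_unitMeasure] with z hz
    have hz0 := hz.1
    rw [scaleAvg_halfMeasure_iterate_below r ha (by positivity),
      scaleAvg_halfMeasure_iterate_below r hb (by positivity)]
    congr 3
    · field_simp
      ring
    · field_simp
      ring
  rw [hcongr]
  refine (mul_le_mul_right (lintegral_hyperVol_mul_le r (by positivity) (by positivity)) _).trans ?_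
  rw [← ENNReal.ofReal_mul (by positivity)]
  apply ENNReal.ofReal_le_ofReal
  have h2 : ((2 : ℝ) ^ (r + 1)) ^ (1 / 5 : ℝ) * ((2 : ℝ) ^ (r + 1)) ^ (4 / 5 : ℝ) =
      2 ^ (r + 1) := by
    rw [← Real.rpow_add (by positivity)]
    norm_num
  have h64 : (64 : ℝ) ^ r ≤ 64 ^ (r + 1) := pow_le_pow_right₀ (by norm_num) (by omega)
  rw [Real.mul_rpow (by positivity) (by positivity), Real.mul_rpow (by positivity) hb]
  have hamgm := rpow_mul_rpow_le ha hb (by positivity : 0 < (n : ℝ) / m)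
  rw [div_div_eq_mul_div, mul_div_assoc] at hamgm
  calc (Nat.gcd m n : ℝ) / n * (17 * 64 ^ r *
        (((2 : ℝ) ^ (r + 1)) ^ (1 / 5 : ℝ) * (a * (n / m)) ^ (1 / 5 : ℝ) *
          (((2 : ℝ) ^ (r + 1)) ^ (4 / 5 : ℝ) * b ^ (4 / 5 : ℝ))))
      = 17 * 64 ^ r * (((2 : ℝ) ^ (r + 1)) ^ (1 / 5 : ℝ) * ((2 : ℝ) ^ (r + 1)) ^ (4 / 5 : ℝ)) *
        (Nat.gcd m n / n * ((a * (n / m)) ^ (1 / 5 : ℝ) * b ^ (4 / 5 : ℝ))) := by ring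
    _ ≤ _ := by
        rw [h2]
        gcongr

/-- The events attached to `m` and `n` are independent up to an error which is small on average
over the pairs `m ≤ n`. -/
theorem cubeMeasure_inter_le {k m n : ℕ} (hk : 0 < k) (hm : 0 < m) (hn : 0 < n) {a b : ℝ}
    (ha : 0 ≤ a) (hb : 0 ≤ b) :
    (cubeMeasure k).real (hyperSet k m a ∩ hyperSet k n b) ≤
      hyperVol k (2 ^ k * a) * hyperVol k (2 ^ k * b) +
      k * (17 * 64 ^ k * 2 ^ k) * (Nat.gcd m n / n * (b * √(n / m) + a * (m / n))) +
      3 ^ k * ((Nat.gcd m n / n) ^ 2 * hyperVol k (2 ^ k * b)) := by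
  set f : ℝ × ℝ → ENNReal := fun z => below a z.1 * below b z.2 with hf
  have hfm : Measurable f :=
    ((measurable_below a).comp measurable_fst).mul ((measurable_below b).comp measurable_snd)
  have hva := hyperVol_nonneg k (by positivity : 0 ≤ 2 ^ k * a)
  have hvb := hyperVol_nonneg k (by positivity : 0 ≤ 2 ^ k * b)
  have h1 : cubeMeasure k (hyperSet k m a ∩ hyperSet k n b) =
      (scaleAvg (jointMeasure m n))^[k] f 1 := by
    rw [jointMeasure, ← lintegral_pi_mul_prod_eq_iterate unitMeasure
      (u := fun x => (distInt (m * x), distInt (n * x))) (by fun_prop) hfm k 1,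
      ← lintegral_indicator_one
        ((measurableSet_hyperSet k m a).inter (measurableSet_hyperSet k n b)), cubeMeasure]
    refine lintegral_congr fun α => ?_
    rw [one_mul]
    simp only [hf, Prod.fst_prod, Prod.snd_prod]
    by_cases h : ∏ i, distInt (m * α i) < a
    · by_cases h' : ∏ i, distInt (n * α i) < b
      · rw [below_of_lt h, below_of_lt h', Set.indicator_of_mem (by exact ⟨h, h'⟩)]
        simp
      · rw [below_of_le (not_lt.mp h'), Set.indicator_of_notMem (by exact fun hα => h' hα.2),
          mul_zero]
    · rw [below_of_le (not_lt.mp h), Set.indicator_of_notMem (by exact fun hα => h hα.1),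
        zero_mul]
  have h2 : (scaleAvg (jointMeasure m n))^[k] f 1 ≤ (scaleAvg (majorantMeasure m n))^[k] f 1 :=
    scaleAvg_iterate_le_of_le (S := nonnegPairs) (ae_nonneg_jointMeasure m n)
      (ae_nonneg_majorantMeasure m n) hfm
      (fun x hx => scaleAvg_jointMeasure_le hm hn a b hx) k 1 nonnegPairs.one_mem
  have h3 := scaleAvg_majorantMeasure_iterate_le (m := m) hn hfm (measurable_below b)
    (fun z => mul_le_of_le_one_left' (below_le_one a z.1)) k 1
  have h4 : (scaleAvg (halfMeasure.prod halfMeasure))^[k] f 1 =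
      ENNReal.ofReal (hyperVol k (2 ^ k * a) * hyperVol k (2 ^ k * b)) := by
    rw [hf, scaleAvg_prod_mul_iterate (measurable_below a) (measurable_below b)]
    simp only [Prod.fst_one, Prod.snd_one]
    rw [scaleAvg_halfMeasure_iterate_below k ha one_pos,
      scaleAvg_halfMeasure_iterate_below k hb one_pos, div_one, div_one,
      ← ENNReal.ofReal_mul hva]
  have h5 : (scaleAvg halfMeasure)^[k] (below b) (1 : ℝ × ℝ).2 =
      ENNReal.ofReal (hyperVol k (2 ^ k * b)) := by
    rw [Prod.snd_one, scaleAvg_halfMeasure_iterate_below k hb one_pos, div_one]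
  have h6 := scaleAvg_lineMeasure_le hk hm hn ha hb
  rw [measureReal_def]
  refine ENNReal.toReal_le_of_le_ofReal (by positivity) ?_
  rw [h1]
  refine (h2.trans h3).trans ?_
  beta_reduce
  rw [h4, h5, ENNReal.ofReal_add (by positivity) (by positivity),
    ENNReal.ofReal_add (by positivity) (by positivity)]
  gcongr
  · rw [mul_assoc (k : ℝ), ENNReal.ofReal_mul (by positivity), ENNReal.ofReal_natCast]
    gcongr
  · rw [ENNReal.ofReal_mul (by positivity), ENNReal.ofReal_mul (by positivity),
      ENNReal.ofReal_pow (by positivity), ENNReal.ofReal_pow (by positivity), mul_assoc]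
    simp

/-! ### Sums over greatest common divisors -/

theorem sum_filter_dvd {d : ℕ} (hd : 0 < d) (N : ℕ) (f : ℕ → ℝ) :
    ∑ m ∈ Finset.Icc 1 N with d ∣ m, f m = ∑ j ∈ Finset.Icc 1 (N / d), f (d * j) := by
  symm
  refine Finset.sum_bij (fun j _ => d * j) ?_ ?_ ?_ ?_
  · intro j hj
    rw [Finset.mem_Icc, Nat.le_div_iff_mul_le hd] at hj
    simp only [Finset.mem_filter, Finset.mem_Icc, dvd_mul_right, and_true]
    exact ⟨Nat.mul_pos hd hj.1, by rw [mul_comm]; exact hj.2⟩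
  · intro i _ j _ h
    exact Nat.eq_of_mul_eq_mul_left hd h
  · intro m hm
    simp only [Finset.mem_filter, Finset.mem_Icc] at hm
    obtain ⟨⟨h1, h2⟩, j, rfl⟩ := hm
    refine ⟨j, ?_, rfl⟩
    rw [Finset.mem_Icc, Nat.le_div_iff_mul_le hd]
    exact ⟨Nat.pos_of_mul_pos_left h1, by rw [mul_comm]; exact h2⟩
  · intro _ _
    rfl

/-- A sum over `gcd(m, n)` is bounded by the sum over all common divisors. -/
theorem sum_gcd_mul_le {n : ℕ} (hn : 0 < n) (N : ℕ) {g f : ℕ → ℝ} (hg : ∀ d, 0 ≤ g d)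
    (hf : ∀ m, 0 ≤ f m) :
    ∑ m ∈ Finset.Icc 1 N, g (Nat.gcd m n) * f m ≤
      ∑ d ∈ n.divisors, g d * ∑ j ∈ Finset.Icc 1 (N / d), f (d * j) := by
  have h1 : ∀ m ∈ Finset.Icc 1 N, g (Nat.gcd m n) * f m ≤
      ∑ d ∈ n.divisors, if d ∣ m then g d * f m else 0 := by
    intro m _
    have hmem : Nat.gcd m n ∈ n.divisors :=
      Nat.mem_divisors.mpr ⟨Nat.gcd_dvd_right m n, hn.ne'⟩
    refine le_trans (le_of_eq ?_) (Finset.single_le_sum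
      (f := fun d => if d ∣ m then g d * f m else 0) (fun d _ => ?_) hmem)
    · simp [Nat.gcd_dvd_left m n]
    · split_ifs
      exacts [mul_nonneg (hg d) (hf m), le_rfl]
  refine (Finset.sum_le_sum h1).trans (le_of_eq ?_)
  rw [Finset.sum_comm]
  refine Finset.sum_congr rfl fun d hd => ?_
  rw [← Finset.sum_filter, ← sum_filter_dvd (Nat.pos_of_mem_divisors hd), Finset.mul_sum]

theorem sum_inv_sqrt_le (N : ℕ) : ∑ j ∈ Finset.Icc 1 N, (√(j : ℝ))⁻¹ ≤ 2 * √(N : ℝ) := by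
  induction N with
  | zero => simp
  | succ N ih =>
    rw [Finset.sum_Icc_succ_top (by omega)]
    have h1 : 0 ≤ √(N : ℝ) := Real.sqrt_nonneg _
    have h2 : 0 < √((N + 1 : ℕ) : ℝ) := Real.sqrt_pos.mpr (by positivity)
    have h3 : √(N : ℝ) ^ 2 = N := Real.sq_sqrt (by positivity)
    have h4 : √((N + 1 : ℕ) : ℝ) ^ 2 = N + 1 := by
      rw [Real.sq_sqrt (by positivity)]
      push_cast
      ring
    have h5 : (√((N + 1 : ℕ) : ℝ))⁻¹ ≤ 2 * √((N + 1 : ℕ) : ℝ) - 2 * √(N : ℝ) := by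
      rw [inv_le_iff_one_le_mul₀ h2]
      nlinarith [sq_nonneg (√((N + 1 : ℕ) : ℝ) - √(N : ℝ))]
    linarith

theorem sum_inv_sq_tail_le {q : ℕ} (hq : 0 < q) (N : ℕ) :
    ∑ j ∈ Finset.Icc 1 N, (if q ≤ j then ((j : ℝ) ^ 2)⁻¹ else 0) ≤ 2 / q := by
  rw [← Finset.sum_filter]
  have hsub : (Finset.Icc 1 N).filter (q ≤ ·) = Finset.Ioo (q - 1) (N + 1) := by
    ext j
    simp only [Finset.mem_filter, Finset.mem_Icc, Finset.mem_Ioo]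
    omega
  rw [hsub]
  refine (sum_Ioo_inv_sq_le (α := ℝ) (q - 1) (N + 1)).trans (le_of_eq ?_)
  rw [Nat.cast_sub hq]
  simp

theorem sum_gcd_mul_sqrt_le {n : ℕ} (hn : 0 < n) :
    ∑ m ∈ Finset.Icc 1 n, (Nat.gcd m n : ℝ) / n * √((n : ℝ) / m) ≤ 2 * n.divisors.card := by
  have hnR : (0 : ℝ) < n := by exact_mod_cast hn
  have hsn : 0 < √(n : ℝ) := Real.sqrt_pos.mpr hnR
  have h := sum_gcd_mul_le hn n (g := fun d => (d : ℝ)) (f := fun m => (√(n : ℝ))⁻¹ * (√(m : ℝ))⁻¹)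
    (fun d => by positivity) (fun m => by positivity)
  refine le_trans (le_of_eq (Finset.sum_congr rfl fun m hm => ?_)) (h.trans ?_)
  · rw [Real.sqrt_div hnR.le]
    have h2 : √(n : ℝ) ^ 2 = n := Real.sq_sqrt hnR.le
    have h3 : 0 < √(m : ℝ) :=
      Real.sqrt_pos.mpr (by exact_mod_cast (Finset.mem_Icc.mp hm).1)
    field_simp
    rw [h2]
  · rw [mul_comm, ← nsmul_eq_mul]
    refine Finset.sum_le_card_nsmul _ _ _ fun d hd => ?_
    obtain ⟨q, rfl⟩ := Nat.dvd_of_mem_divisors hd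
    have hd0 : 0 < d := Nat.pos_of_mem_divisors hd
    have hdR : (0 : ℝ) < d := by exact_mod_cast hd0
    have hsd : 0 < √(d : ℝ) := Real.sqrt_pos.mpr hdR
    have hsd2 : √(d : ℝ) ^ 2 = d := Real.sq_sqrt hdR.le
    have hsq : 0 < √(q : ℝ) :=
      Real.sqrt_pos.mpr (by exact_mod_cast Nat.pos_of_mul_pos_left hn)
    rw [Nat.mul_div_cancel_left q hd0]
    simp only [Nat.cast_mul, Real.sqrt_mul hdR.le, mul_inv]
    rw [← Finset.mul_sum, ← Finset.mul_sum]
    have hs := sum_inv_sqrt_le q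
    calc (d : ℝ) * ((√(d : ℝ))⁻¹ * (√(q : ℝ))⁻¹ *
          ((√(d : ℝ))⁻¹ * ∑ j ∈ Finset.Icc 1 q, (√(j : ℝ))⁻¹))
        ≤ d * ((√(d : ℝ))⁻¹ * (√(q : ℝ))⁻¹ * ((√(d : ℝ))⁻¹ * (2 * √(q : ℝ)))) := by gcongr
      _ = 2 := by
          field_simp
          rw [hsd2]

theorem sum_gcd_mul_inv_sq_le {m : ℕ} (hm : 0 < m) (N : ℕ) :
    ∑ n ∈ Finset.Icc 1 N, (if m ≤ n then (Nat.gcd m n : ℝ) / n * ((m : ℝ) / n) else 0) ≤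
      2 * m.divisors.card := by
  have h := sum_gcd_mul_le hm N (g := fun d => (d : ℝ))
    (f := fun n => (m : ℝ) * if m ≤ n then ((n : ℝ) ^ 2)⁻¹ else 0)
    (fun d => by positivity) (fun n => by positivity)
  refine le_trans (le_of_eq (Finset.sum_congr rfl fun n hn => ?_)) (h.trans ?_)
  · rw [Nat.gcd_comm]
    split_ifs
    · field_simp
    · ring
  · rw [mul_comm, ← nsmul_eq_mul]
    refine Finset.sum_le_card_nsmul _ _ _ fun d hd => ?_
    obtain ⟨q, rfl⟩ := Nat.dvd_of_mem_divisors hd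
    have hd0 : 0 < d := Nat.pos_of_mem_divisors hd
    have hdR : (0 : ℝ) < d := by exact_mod_cast hd0
    have hq : 0 < q := Nat.pos_of_mul_pos_left hm
    have hqR : (0 : ℝ) < q := by exact_mod_cast hq
    have hterm : ∀ j : ℕ, ((d * q : ℕ) : ℝ) *
        (if d * q ≤ d * j then (((d * j : ℕ) : ℝ) ^ 2)⁻¹ else 0) =
        (q / d) * if q ≤ j then ((j : ℝ) ^ 2)⁻¹ else 0 := by
      intro j
      simp only [Nat.mul_le_mul_left_iff hd0]
      split_ifs
      · push_cast
        field_simp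
      · ring
    simp only [hterm]
    rw [← Finset.mul_sum]
    have hs := sum_inv_sq_tail_le hq (N / d)
    calc (d : ℝ) * (q / d * ∑ j ∈ Finset.Icc 1 (N / d), if q ≤ j then ((j : ℝ) ^ 2)⁻¹ else 0)
        ≤ d * (q / d * (2 / q)) := by gcongr
      _ = 2 := by field_simp

theorem sum_gcd_sq_le {n : ℕ} (hn : 0 < n) :
    ∑ m ∈ Finset.Icc 1 n, ((Nat.gcd m n : ℝ) / n) ^ 2 ≤ ∑ d ∈ n.divisors, (d : ℝ)⁻¹ := by
  have hnR : (0 : ℝ) < n := by exact_mod_cast hn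
  have h := sum_gcd_mul_le hn n (g := fun d => (d : ℝ) ^ 2) (f := fun _ => ((n : ℝ) ^ 2)⁻¹)
    (fun d => by positivity) (fun m => by positivity)
  refine le_trans (le_of_eq (Finset.sum_congr rfl fun m _ => ?_)) (h.trans ?_)
  · rw [div_pow, div_eq_mul_inv]
  · rw [← Nat.sum_div_divisors n fun d => (d : ℝ)⁻¹]
    refine le_of_eq (Finset.sum_congr rfl fun d hd => ?_)
    obtain ⟨q, rfl⟩ := Nat.dvd_of_mem_divisors hd
    have hd0 : 0 < d := Nat.pos_of_mem_divisors hd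
    have hdR : (0 : ℝ) < d := by exact_mod_cast hd0
    have hqR : (0 : ℝ) < q := by exact_mod_cast Nat.pos_of_mul_pos_left hn
    rw [Nat.mul_div_cancel_left q hd0]
    simp only [Finset.sum_const, Nat.card_Icc, Nat.add_sub_cancel, nsmul_eq_mul]
    push_cast
    field_simp

/-! ### Weighted divisor sums -/

/-- Comparison of the partial sums of two sequences passes to antitone nonnegative weights. -/
theorem sum_mul_le_sum_mul_of_antitone {w a b : ℕ → ℝ} (hw : ∀ n, 1 ≤ n → 0 ≤ w n)
    (hanti : AntitoneOn w (Set.Ici 1))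
    (hab : ∀ N, ∑ n ∈ Finset.Icc 1 N, a n ≤ ∑ n ∈ Finset.Icc 1 N, b n) (N : ℕ) :
    ∑ n ∈ Finset.Icc 1 N, w n * a n ≤ ∑ n ∈ Finset.Icc 1 N, w n * b n := by
  rcases Nat.eq_zero_or_pos N with rfl | hN
  · simp
  have key : ∀ N, 1 ≤ N → w N * ∑ n ∈ Finset.Icc 1 N, (b n - a n) ≤
      ∑ n ∈ Finset.Icc 1 N, w n * (b n - a n) := by
    intro N hN
    induction N, hN using Nat.le_induction with
    | base => simp
    | succ N hN ih =>
      rw [Finset.sum_Icc_succ_top (by omega), Finset.sum_Icc_succ_top (by omega), mul_add]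
      have h0 : 0 ≤ ∑ n ∈ Finset.Icc 1 N, (b n - a n) := by
        rw [Finset.sum_sub_distrib]
        linarith [hab N]
      have h1 : w (N + 1) ≤ w N := hanti hN (by simp : N + 1 ∈ Set.Ici 1) (by omega)
      have h2 := mul_le_mul_of_nonneg_right h1 h0
      linarith
  have h1 := key N hN
  have h2 : 0 ≤ w N * ∑ n ∈ Finset.Icc 1 N, (b n - a n) := by
    refine mul_nonneg (hw N hN) ?_
    rw [Finset.sum_sub_distrib]
    linarith [hab N]
  simp only [mul_sub, Finset.sum_sub_distrib] at h1 h2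
  linarith

theorem sum_sum_divisors_le (N : ℕ) {g : ℕ → ℝ} (hg : ∀ d, 0 ≤ g d) :
    ∑ n ∈ Finset.Icc 1 N, ∑ d ∈ n.divisors, g d ≤ N * ∑ d ∈ Finset.Icc 1 N, g d / d := by
  have h1 : ∀ n ∈ Finset.Icc 1 N, ∑ d ∈ n.divisors, g d =
      ∑ d ∈ Finset.Icc 1 N, if d ∣ n then g d else 0 := by
    intro n hn
    rw [Finset.mem_Icc] at hn
    rw [← Finset.sum_filter]
    refine Finset.sum_congr ?_ fun _ _ => rfl
    ext d
    simp only [Nat.mem_divisors, Finset.mem_filter, Finset.mem_Icc]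
    constructor
    · rintro ⟨h, h0⟩
      exact ⟨⟨Nat.pos_of_dvd_of_pos h hn.1, (Nat.le_of_dvd hn.1 h).trans hn.2⟩, h⟩
    · rintro ⟨_, h⟩
      exact ⟨h, by omega⟩
  rw [Finset.sum_congr rfl h1, Finset.sum_comm, Finset.mul_sum]
  refine Finset.sum_le_sum fun d hd => ?_
  have hd0 : 0 < d := (Finset.mem_Icc.mp hd).1
  rw [← Finset.sum_filter, sum_filter_dvd hd0 N fun _ => g d, Finset.sum_const, Nat.card_Icc,
    Nat.add_sub_cancel, nsmul_eq_mul, ← mul_div_assoc, mul_comm (N : ℝ), mul_div_assoc, mul_comm]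
  exact mul_le_mul_of_nonneg_left Nat.cast_div_le (hg d)

theorem sum_card_divisors_le (N : ℕ) :
    ∑ n ∈ Finset.Icc 1 N, (n.divisors.card : ℝ) ≤ ∑ n ∈ Finset.Icc 1 N, (2 + Real.log n) := by
  rcases Nat.eq_zero_or_pos N with rfl | hN
  · simp
  have hNR : (0 : ℝ) < N := by exact_mod_cast hN
  have h1 := sum_sum_divisors_le N (g := fun _ => 1) fun _ => zero_le_one
  simp only [Finset.sum_const, nsmul_eq_mul, mul_one, one_div] at h1
  have h2 : ∑ d ∈ Finset.Icc 1 N, (d : ℝ)⁻¹ ≤ 1 + Real.log N := by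
    have := harmonic_le_one_add_log N
    rw [harmonic_eq_sum_Icc] at this
    push_cast at this
    exact this
  have h3 : ∀ M : ℕ, ∑ n ∈ Finset.Icc 1 M, Real.log n = Real.log (M.factorial) := by
    intro M
    induction M with
    | zero => simp
    | succ M ih =>
      rw [Finset.sum_Icc_succ_top (by omega), ih, Nat.factorial_succ, Nat.cast_mul,
        Real.log_mul (by positivity) (by positivity), add_comm]
  have h4 : N * Real.log N - N ≤ Real.log N.factorial := by
    have h := Real.pow_div_factorial_le_exp (N : ℝ) hNR.le N
    have h' := Real.log_le_log (by positivity) h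
    rw [Real.log_exp, Real.log_div (by positivity) (by positivity), Real.log_pow] at h'
    linarith
  rw [Finset.sum_add_distrib, h3]
  simp only [Finset.sum_const, Nat.card_Icc, Nat.add_sub_cancel, nsmul_eq_mul]
  have h5 := mul_le_mul_of_nonneg_left h2 hNR.le
  linarith

theorem sum_inv_divisors_le (N : ℕ) :
    ∑ n ∈ Finset.Icc 1 N, ∑ d ∈ n.divisors, (d : ℝ)⁻¹ ≤ ∑ _n ∈ Finset.Icc 1 N, (2 : ℝ) := by
  refine (sum_sum_divisors_le N (g := fun d => (d : ℝ)⁻¹) fun d => by positivity).trans ?_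
  have h := sum_inv_sq_tail_le one_pos N
  have h' : ∑ d ∈ Finset.Icc 1 N, (d : ℝ)⁻¹ / d ≤ 2 := by
    refine le_trans (le_of_eq (Finset.sum_congr rfl fun d hd => ?_)) (h.trans (by norm_num))
    rw [if_pos (Finset.mem_Icc.mp hd).1, sq, mul_inv, div_eq_mul_inv]
  rw [Finset.sum_const, Nat.card_Icc, Nat.add_sub_cancel, nsmul_eq_mul]
  gcongr

/-! ### The second moment -/

/-- For `k ≥ 2` the measure of the event carries a logarithm, which is what absorbs
`log n` below. -/
theorem le_hyperVol {k : ℕ} (hk : 2 ≤ k) {a : ℝ} (ha0 : 0 ≤ a) (ha : a ≤ 1 / 2) :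
    a ≤ hyperVol k (2 ^ k * a) ∧ a * -Real.log a ≤ hyperVol k (2 ^ k * a) := by
  rcases ha0.eq_or_lt with rfl | ha0
  · simp [hyperVol_zero_right]
  rcases lt_or_ge 1 (2 ^ k * a) with h | h
  · rw [hyperVol_of_gt h]
    refine ⟨by linarith, ?_⟩
    have h1 := Real.one_sub_inv_le_log_of_pos ha0
    have h2 : a * (1 - a⁻¹) ≤ a * Real.log a := by gcongr
    rw [mul_sub, mul_inv_cancel₀ ha0.ne'] at h2
    linarith
  · set t := 2 ^ k * a with ht
    have ht0 : 0 < t := by positivity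
    have hlog : 0 ≤ -Real.log t := by linarith [Real.log_nonpos ht0.le h]
    have hlow : t * (1 - Real.log t) ≤ hyperVol k t := by
      rw [hyperVol_of_le h]
      gcongr
      have hsub : Finset.range 2 ⊆ Finset.range k := Finset.range_subset_range.mpr hk
      refine le_trans (le_of_eq ?_)
        (Finset.sum_le_sum_of_subset_of_nonneg hsub fun j _ _ => by positivity)
      simp [Finset.sum_range_succ, sub_eq_add_neg]
    have hpow : (1 : ℝ) ≤ 2 ^ k := one_le_pow₀ (by norm_num)
    have hkpow : (k : ℝ) ≤ 2 ^ k := by exact_mod_cast (Nat.lt_two_pow_self).le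
    have hat : a ≤ t := le_mul_of_one_le_left ha0.le hpow
    have h1 : t ≤ t * (1 - Real.log t) := le_mul_of_one_le_right ht0.le (by linarith)
    refine ⟨hat.trans (h1.trans hlow), le_trans ?_ hlow⟩
    have hloga : Real.log t = k * Real.log 2 + Real.log a := by
      rw [ht, Real.log_mul (by positivity) ha0.ne', Real.log_pow]
    have hlog2 : Real.log 2 ≤ 1 := by linarith [Real.log_two_lt_d9]
    have h2 : a * (k * Real.log 2) ≤ t := by
      calc a * (k * Real.log 2) ≤ a * (2 ^ k * 1) := by
            gcongr
        _ = t := by rw [ht]; ring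
    have h3 : a * -Real.log t ≤ t * -Real.log t := by gcongr
    have h4 : -Real.log a = k * Real.log 2 + -Real.log t := by linarith
    rw [h4, mul_add]
    linarith

/-- The expected number of `n ≤ N` with `‖n α₁‖ ⋯ ‖n α_k‖ < ψ(n)`. -/
def expectedCount (k : ℕ) (ψ : ℕ → ℝ) (N : ℕ) : ℝ :=
  ∑ n ∈ Finset.Icc 1 N, hyperVol k (2 ^ k * ψ n)

section SecondMoment

variable {k : ℕ} {ψ : ℕ → ℝ}

theorem expectedCount_nonneg (hψ : ∀ n : ℕ, 1 ≤ n → ψ n ∈ Set.Icc (0 : ℝ) (1 / 2)) (N : ℕ) :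
    0 ≤ expectedCount k ψ N :=
  Finset.sum_nonneg fun n hn => hyperVol_nonneg k
    (mul_nonneg (by positivity) (hψ n (Finset.mem_Icc.mp hn).1).1)

theorem expectedCount_mono (hψ : ∀ n : ℕ, 1 ≤ n → ψ n ∈ Set.Icc (0 : ℝ) (1 / 2)) :
    Monotone (expectedCount k ψ) := by
  intro M N h
  refine Finset.sum_le_sum_of_subset_of_nonneg (Finset.Icc_subset_Icc_right h) fun n hn _ => ?_
  exact hyperVol_nonneg k (mul_nonneg (by positivity) (hψ n (Finset.mem_Icc.mp hn).1).1)

theorem mul_le_expectedCount (hk : 2 ≤ k) (hψ : ∀ n : ℕ, 1 ≤ n → ψ n ∈ Set.Icc (0 : ℝ) (1 / 2))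
    (hanti : AntitoneOn ψ (Set.Ici 1)) {n N : ℕ} (hn : 1 ≤ n) (hnN : n ≤ N) :
    n * ψ n ≤ expectedCount k ψ N := by
  refine le_trans ?_ (expectedCount_mono hψ hnN)
  have h : ∑ _i ∈ Finset.Icc 1 n, ψ n ≤ expectedCount k ψ n := by
    refine Finset.sum_le_sum fun i hi => ?_
    rw [Finset.mem_Icc] at hi
    exact (hanti hi.1 hn hi.2).trans (le_hyperVol hk (hψ i hi.1).1 (hψ i hi.1).2).1
  simpa using h

/-- If `ψ n ≤ n ^ (-1/2)` the factor `log n` is absorbed by the logarithm in the measure of the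
event; otherwise `√n ≤ n ψ(n)` is at most the expected count. -/
theorem mul_log_le (hk : 2 ≤ k) (hψ : ∀ n : ℕ, 1 ≤ n → ψ n ∈ Set.Icc (0 : ℝ) (1 / 2))
    (hanti : AntitoneOn ψ (Set.Ici 1)) {n N : ℕ} (hn : 1 ≤ n) (hnN : n ≤ N) :
    ψ n * (2 + Real.log n) ≤
      hyperVol k (2 ^ k * ψ n) * (4 + 4 * √(expectedCount k ψ N)) := by
  obtain ⟨h1, h2⟩ := le_hyperVol hk (hψ n hn).1 (hψ n hn).2
  have hv0 : 0 ≤ hyperVol k (2 ^ k * ψ n) := (hψ n hn).1.trans h1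
  have hnR : (0 : ℝ) < n := by exact_mod_cast hn
  have hsn : 0 < √(n : ℝ) := Real.sqrt_pos.mpr hnR
  set v := hyperVol k (2 ^ k * ψ n)
  set V := expectedCount k ψ N
  have hsV : 0 ≤ √V := Real.sqrt_nonneg V
  rcases (hψ n hn).1.eq_or_lt with h0 | h0
  · rw [← h0, zero_mul]
    positivity
  have hlogn : Real.log n = 2 * Real.log √(n : ℝ) := by
    rw [Real.log_sqrt hnR.le]
    ring
  have hvV : 0 ≤ v * √V := by positivity
  rcases le_or_gt (ψ n * √(n : ℝ)) 1 with h | h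
  · have h3 : Real.log √(n : ℝ) ≤ -Real.log (ψ n) := by
      have := Real.log_nonpos (by positivity) h
      rw [Real.log_mul h0.ne' hsn.ne'] at this
      linarith
    have h4 : ψ n * Real.log √(n : ℝ) ≤ v := le_trans (by gcongr) h2
    rw [hlogn]
    linarith
  · have h3 : √(n : ℝ) ≤ V := by
      refine le_trans ?_ (mul_le_expectedCount hk hψ hanti hn hnN)
      nlinarith [Real.sq_sqrt hnR.le]
    have h4 : Real.log √(n : ℝ) ≤ 2 * √V := by
      have h5 : Real.log √(n : ℝ) = 2 * Real.log √√(n : ℝ) := by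
        rw [Real.log_sqrt hsn.le]
        ring
      have h6 := Real.log_le_self (Real.sqrt_nonneg √(n : ℝ))
      have h7 := Real.sqrt_le_sqrt h3
      linarith
    have h5 : ψ n * (2 + Real.log n) ≤ v * (2 + 4 * √V) := by
      rw [hlogn]
      have : 0 ≤ Real.log √(n : ℝ) := by
        refine Real.log_nonneg ?_
        rw [Real.one_le_sqrt]
        exact_mod_cast hn
      exact mul_le_mul h1 (by linarith) (by linarith) hv0
    linarith

theorem sum_mul_card_divisors_le (hk : 2 ≤ k)
    (hψ : ∀ n : ℕ, 1 ≤ n → ψ n ∈ Set.Icc (0 : ℝ) (1 / 2))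
    (hanti : AntitoneOn ψ (Set.Ici 1)) (N : ℕ) :
    ∑ n ∈ Finset.Icc 1 N, ψ n * n.divisors.card ≤
      expectedCount k ψ N * (4 + 4 * √(expectedCount k ψ N)) := by
  refine (sum_mul_le_sum_mul_of_antitone (fun n hn => (hψ n hn).1) hanti
    sum_card_divisors_le N).trans ?_
  rw [expectedCount, Finset.sum_mul]
  refine Finset.sum_le_sum fun n hn => ?_
  rw [Finset.mem_Icc] at hn
  exact mul_log_le hk hψ hanti hn.1 hn.2

theorem sum_hyperVol_mul_inv_divisors_le
    (hψ : ∀ n : ℕ, 1 ≤ n → ψ n ∈ Set.Icc (0 : ℝ) (1 / 2))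
    (hanti : AntitoneOn ψ (Set.Ici 1)) (N : ℕ) :
    ∑ n ∈ Finset.Icc 1 N, hyperVol k (2 ^ k * ψ n) * ∑ d ∈ n.divisors, (d : ℝ)⁻¹ ≤
      2 * expectedCount k ψ N := by
  refine (sum_mul_le_sum_mul_of_antitone (fun n hn => hyperVol_nonneg k
    (mul_nonneg (by positivity) (hψ n hn).1)) (fun i hi j hj hij =>
      hyperVol_mul_pow_le_of_le k (hψ j hj).1 (hanti hi hj hij)) sum_inv_divisors_le N).trans
    (le_of_eq ?_)
  rw [expectedCount, ← Finset.sum_mul, mul_comm]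

theorem sum_sum_le_two_mul_of_symm {N : ℕ} {c b : ℕ → ℕ → ℝ} (hsymm : ∀ m n, c m n = c n m)
    (hb : ∀ m n, 1 ≤ m → 1 ≤ n → 0 ≤ b m n) (hcb : ∀ m n, 1 ≤ m → 1 ≤ n → c m n ≤ b m n) :
    ∑ m ∈ Finset.Icc 1 N, ∑ n ∈ Finset.Icc 1 N, c m n ≤
      2 * ∑ n ∈ Finset.Icc 1 N, ∑ m ∈ Finset.Icc 1 N, if m ≤ n then b m n else 0 := by
  have h : ∀ m ∈ Finset.Icc 1 N, ∀ n ∈ Finset.Icc 1 N,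
      c m n ≤ (if m ≤ n then b m n else 0) + if n ≤ m then b n m else 0 := by
    intro m hm n hn
    have hm1 := (Finset.mem_Icc.mp hm).1
    have hn1 := (Finset.mem_Icc.mp hn).1
    have h1 := hcb m n hm1 hn1
    have h2 := hcb n m hn1 hm1
    have h3 := hb m n hm1 hn1
    have h4 := hb n m hn1 hm1
    have h5 := hsymm m n
    rcases le_total m n with hmn | hmn
    · rw [if_pos hmn]
      split_ifs <;> linarith
    · rw [if_pos hmn]
      split_ifs <;> linarith
  refine (Finset.sum_le_sum fun m hm => Finset.sum_le_sum fun n hn => h m hm n hn).trans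
    (le_of_eq ?_)
  simp only [Finset.sum_add_distrib]
  rw [two_mul, Finset.sum_comm]

/-- The number of `n ≤ N` with `‖n α₁‖ ⋯ ‖n α_k‖ < ψ(n)`. -/
def hyperCount (k : ℕ) (ψ : ℕ → ℝ) (N : ℕ) (α : Fin k → ℝ) : ℝ :=
  ∑ n ∈ Finset.Icc 1 N, (hyperSet k n (ψ n)).indicator 1 α

theorem measurable_hyperCount (N : ℕ) : Measurable (hyperCount k ψ N) := by
  unfold hyperCount
  refine Finset.measurable_fun_sum _ fun n _ => ?_
  exact measurable_one.indicator (measurableSet_hyperSet k n (ψ n))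

theorem integral_hyperCount_sub_sq (hψ : ∀ n : ℕ, 1 ≤ n → ψ n ∈ Set.Icc (0 : ℝ) (1 / 2)) (N : ℕ) :
    Integrable (fun α => (hyperCount k ψ N α - expectedCount k ψ N) ^ 2) (cubeMeasure k) ∧
    ∫ α, (hyperCount k ψ N α - expectedCount k ψ N) ^ 2 ∂cubeMeasure k =
      ∑ m ∈ Finset.Icc 1 N, ∑ n ∈ Finset.Icc 1 N,
        ((cubeMeasure k).real (hyperSet k m (ψ m) ∩ hyperSet k n (ψ n)) -
          hyperVol k (2 ^ k * ψ m) * hyperVol k (2 ^ k * ψ n)) := by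
  set A : ℕ → Set (Fin k → ℝ) := fun n => hyperSet k n (ψ n) with hA
  set v : ℕ → ℝ := fun n => hyperVol k (2 ^ k * ψ n) with hv
  have hAm : ∀ n, MeasurableSet (A n) := fun n => measurableSet_hyperSet k n (ψ n)
  have hPA : ∀ n, 1 ≤ n → (cubeMeasure k).real (A n) = v n := by
    intro n hn
    rw [measureReal_def, cubeMeasure_hyperSet hn (hψ n hn).1, ENNReal.toReal_ofReal]
    exact hyperVol_nonneg k (mul_nonneg (by positivity) (hψ n hn).1)
  have hint : ∀ S : Set (Fin k → ℝ), MeasurableSet S →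
      Integrable (S.indicator (1 : (Fin k → ℝ) → ℝ)) (cubeMeasure k) := fun S hS =>
    (integrable_const (1 : ℝ)).indicator hS
  have hexp : ∀ α, (hyperCount k ψ N α - expectedCount k ψ N) ^ 2 =
      ∑ m ∈ Finset.Icc 1 N, ∑ n ∈ Finset.Icc 1 N, ((A m ∩ A n).indicator 1 α -
        v m * (A n).indicator 1 α - v n * (A m).indicator 1 α + v m * v n) := by
    intro α
    rw [hyperCount, expectedCount, ← Finset.sum_sub_distrib, sq, Finset.sum_mul_sum]
    refine Finset.sum_congr rfl fun m _ => Finset.sum_congr rfl fun n _ => ?_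
    rw [Set.inter_indicator_one, Pi.mul_apply]
    simp only [hA, hv]
    ring
  have hi : ∀ m n, Integrable (fun α => (A m ∩ A n).indicator (1 : (Fin k → ℝ) → ℝ) α -
        v m * (A n).indicator 1 α - v n * (A m).indicator 1 α + v m * v n) (cubeMeasure k) :=
    fun m n => (((hint _ ((hAm m).inter (hAm n))).sub ((hint _ (hAm n)).const_mul _)).sub
      ((hint _ (hAm m)).const_mul _)).add (integrable_const _)
  simp only [hexp]
  refine ⟨integrable_finsetSum _ fun m _ => integrable_finsetSum _ fun n _ => hi m n, ?_⟩
  rw [integral_finsetSum _ fun m _ => integrable_finsetSum _ fun n _ => hi m n]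
  refine Finset.sum_congr rfl fun m hm => ?_
  rw [integral_finsetSum _ fun n _ => hi m n]
  refine Finset.sum_congr rfl fun n hn => ?_
  have i1 := hint _ ((hAm m).inter (hAm n))
  have i2 := (hint _ (hAm n)).const_mul (v m)
  have i3 := (hint _ (hAm m)).const_mul (v n)
  refine (integral_add ((i1.sub i2).sub i3) (integrable_const _)).trans ?_
  rw [integral_sub' (i1.sub i2) i3, integral_sub' i1 i2, integral_const_mul, integral_const_mul,
    integral_indicator_one (hAm m), integral_indicator_one (hAm n),
    integral_indicator_one ((hAm m).inter (hAm n)),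
    hPA m (Finset.mem_Icc.mp hm).1, hPA n (Finset.mem_Icc.mp hn).1]
  simp
  ring

/-- The variance of the counting function is at most of the order of the power `3 / 2` of its mean,
once the mean is at least one. -/
theorem exists_integral_sq_le (hk : 2 ≤ k) : ∃ C : ℝ, 0 ≤ C ∧ ∀ ψ : ℕ → ℝ,
    (∀ n : ℕ, 1 ≤ n → ψ n ∈ Set.Icc (0 : ℝ) (1 / 2)) → AntitoneOn ψ (Set.Ici 1) → ∀ N : ℕ,
    ∫ α, (hyperCount k ψ N α - expectedCount k ψ N) ^ 2 ∂cubeMeasure k ≤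
      C * (expectedCount k ψ N * (1 + √(expectedCount k ψ N))) := by
  set C₁ : ℝ := k * (17 * 64 ^ k * 2 ^ k) with hC₁
  have hC₁0 : 0 ≤ C₁ := by positivity
  refine ⟨2 * (C₁ * 16 + 3 ^ k * 2), by positivity, fun ψ hψ hanti N => ?_⟩
  set V := expectedCount k ψ N with hV
  have hV0 : 0 ≤ V := expectedCount_nonneg hψ N
  have hsV : 0 ≤ √V := Real.sqrt_nonneg V
  have hv0 : ∀ n, 1 ≤ n → 0 ≤ hyperVol k (2 ^ k * ψ n) := fun n hn =>
    hyperVol_nonneg k (mul_nonneg (by positivity) (hψ n hn).1)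
  set b₁ : ℕ → ℕ → ℝ := fun m n => ψ n * (Nat.gcd m n / n * √(n / m)) with hb₁
  set b₂ : ℕ → ℕ → ℝ := fun m n => ψ m * (Nat.gcd m n / n * (m / n)) with hb₂
  set b₃ : ℕ → ℕ → ℝ := fun m n => hyperVol k (2 ^ k * ψ n) * (Nat.gcd m n / n) ^ 2 with hb₃
  rw [(integral_hyperCount_sub_sq hψ N).2]
  refine (sum_sum_le_two_mul_of_symm (b := fun m n => C₁ * (b₁ m n + b₂ m n) + 3 ^ k * b₃ m n)
    (fun m n => by rw [Set.inter_comm, mul_comm]) (fun m n hm hn => ?_)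
    (fun m n hm hn => ?_)).trans ?_
  · have := (hψ m hm).1
    have := (hψ n hn).1
    have := hv0 n hn
    positivity
  · have h := cubeMeasure_inter_le (k := k) (by omega) hm hn (hψ m hm).1 (hψ n hn).1
    have e : k * (17 * 64 ^ k * 2 ^ k) *
        (Nat.gcd m n / n * (ψ n * √(n / m) + ψ m * (m / n))) +
        3 ^ k * ((Nat.gcd m n / n) ^ 2 * hyperVol k (2 ^ k * ψ n)) =
        C₁ * (b₁ m n + b₂ m n) + 3 ^ k * b₃ m n := by
      simp only [hb₁, hb₂, hb₃, hC₁]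
      ring
    rw [← e]
    linarith
  have hfilter : ∀ n ∈ Finset.Icc 1 N, ∀ F : ℕ → ℝ,
      ∑ m ∈ Finset.Icc 1 N, (if m ≤ n then F m else 0) = ∑ m ∈ Finset.Icc 1 n, F m := by
    intro n hn F
    rw [← Finset.sum_filter]
    refine Finset.sum_congr ?_ fun _ _ => rfl
    ext m
    rw [Finset.mem_Icc] at hn
    simp only [Finset.mem_filter, Finset.mem_Icc]
    omega
  have hτ := sum_mul_card_divisors_le hk hψ hanti N
  have s₁ : ∑ n ∈ Finset.Icc 1 N, ∑ m ∈ Finset.Icc 1 N, (if m ≤ n then b₁ m n else 0) ≤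
      2 * (V * (4 + 4 * √V)) := by
    refine le_trans ?_ (mul_le_mul_of_nonneg_left hτ zero_le_two)
    rw [Finset.mul_sum]
    refine Finset.sum_le_sum fun n hn => ?_
    rw [hfilter n hn, ← Finset.mul_sum]
    have hn1 := (Finset.mem_Icc.mp hn).1
    have := mul_le_mul_of_nonneg_left (sum_gcd_mul_sqrt_le hn1) (hψ n hn1).1
    linarith
  have s₂ : ∑ n ∈ Finset.Icc 1 N, ∑ m ∈ Finset.Icc 1 N, (if m ≤ n then b₂ m n else 0) ≤
      2 * (V * (4 + 4 * √V)) := by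
    refine le_trans ?_ (mul_le_mul_of_nonneg_left hτ zero_le_two)
    rw [Finset.mul_sum, Finset.sum_comm]
    refine Finset.sum_le_sum fun m hm => ?_
    have hm1 := (Finset.mem_Icc.mp hm).1
    have := mul_le_mul_of_nonneg_left (sum_gcd_mul_inv_sq_le hm1 N) (hψ m hm1).1
    have hout : ∀ n, (if m ≤ n then b₂ m n else 0) =
        ψ m * if m ≤ n then (Nat.gcd m n : ℝ) / n * ((m : ℝ) / n) else 0 := by
      intro n
      split_ifs
      · rfl
      · rw [mul_zero]
    simp only [hout]
    rw [← Finset.mul_sum]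
    linarith
  have s₃ : ∑ n ∈ Finset.Icc 1 N, ∑ m ∈ Finset.Icc 1 N, (if m ≤ n then b₃ m n else 0) ≤
      2 * V := by
    refine le_trans (Finset.sum_le_sum fun n hn => ?_)
      (sum_hyperVol_mul_inv_divisors_le hψ hanti N)
    rw [hfilter n hn, ← Finset.mul_sum]
    have hn1 := (Finset.mem_Icc.mp hn).1
    exact mul_le_mul_of_nonneg_left (sum_gcd_sq_le hn1) (hv0 n hn1)
  have hsplit : ∑ n ∈ Finset.Icc 1 N, ∑ m ∈ Finset.Icc 1 N,
      (if m ≤ n then C₁ * (b₁ m n + b₂ m n) + 3 ^ k * b₃ m n else 0) =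
      C₁ * (∑ n ∈ Finset.Icc 1 N, ∑ m ∈ Finset.Icc 1 N, (if m ≤ n then b₁ m n else 0) +
        ∑ n ∈ Finset.Icc 1 N, ∑ m ∈ Finset.Icc 1 N, (if m ≤ n then b₂ m n else 0)) +
      3 ^ k * ∑ n ∈ Finset.Icc 1 N, ∑ m ∈ Finset.Icc 1 N, (if m ≤ n then b₃ m n else 0) := by
    simp only [Finset.mul_sum, ← Finset.sum_add_distrib]
    refine Finset.sum_congr rfl fun n _ => Finset.sum_congr rfl fun m _ => ?_
    split_ifs <;> ring
  rw [hsplit]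
  have hfin : C₁ * (2 * (V * (4 + 4 * √V)) + 2 * (V * (4 + 4 * √V))) + 3 ^ k * (2 * V) ≤
      (C₁ * 16 + 3 ^ k * 2) * (V * (1 + √V)) := by
    have : 0 ≤ (3 : ℝ) ^ k * 2 * (V * √V) := by positivity
    linarith
  have : C₁ * (∑ n ∈ Finset.Icc 1 N, ∑ m ∈ Finset.Icc 1 N, (if m ≤ n then b₁ m n else 0) +
        ∑ n ∈ Finset.Icc 1 N, ∑ m ∈ Finset.Icc 1 N, (if m ≤ n then b₂ m n else 0)) +
      3 ^ k * ∑ n ∈ Finset.Icc 1 N, ∑ m ∈ Finset.Icc 1 N, (if m ≤ n then b₃ m n else 0) ≤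
      C₁ * (2 * (V * (4 + 4 * √V)) + 2 * (V * (4 + 4 * √V))) + 3 ^ k * (2 * V) := by
    gcongr
  linarith

end SecondMoment

/-! ### From the second moment to almost everywhere convergence -/

theorem tendsto_div_one_of_pow_four {U : ℕ → ℝ} (h1 : ∀ i : ℕ, (i : ℝ) ^ 4 ≤ U i)
    (h2 : ∀ i : ℕ, U i ≤ (i : ℝ) ^ 4 + 1) : Tendsto (fun i => U (i + 1) / U i) atTop (nhds 1) := by
  have hinv : Tendsto (fun i : ℕ => ((i : ℝ))⁻¹) atTop (nhds 0) :=
    tendsto_inv_atTop_nhds_zero_nat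
  have hU : Tendsto (fun i : ℕ => U i / (i : ℝ) ^ 4) atTop (nhds 1) := by
    refine tendsto_of_tendsto_of_tendsto_of_le_of_le' tendsto_const_nhds
      (by simpa using (hinv.pow 4).const_add 1) ?_ ?_
    · filter_upwards [eventually_gt_atTop 0] with i hi
      rw [le_div_iff₀ (by positivity), one_mul]
      exact h1 i
    · filter_upwards [eventually_gt_atTop 0] with i hi
      rw [div_le_iff₀ (by positivity), add_mul,
        inv_mul_cancel₀ (by positivity), one_mul]
      exact h2 i
  have hU' := hU.comp (tendsto_add_atTop_nat 1)
  have hq : Tendsto (fun i : ℕ => (1 + (i : ℝ)⁻¹) ^ 4) atTop (nhds 1) := by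
    simpa using (hinv.const_add 1).pow 4
  have h := (hU'.mul hq).div hU one_ne_zero
  rw [mul_one, div_one] at h
  refine h.congr' ?_
  filter_upwards [eventually_gt_atTop 0] with i hi
  have hi' : (0 : ℝ) < i := by exact_mod_cast hi
  have : 0 < U i := lt_of_lt_of_le (by positivity) (h1 i)
  simp only [Function.comp_apply, Pi.div_apply]
  push_cast
  field_simp

/-- The first index at which `V` reaches `i ^ 4`. -/
theorem exists_index {V : ℕ → ℝ} (hV0 : V 0 = 0) (hstep : ∀ N, V (N + 1) ≤ V N + 1)
    (htop : Tendsto V atTop atTop) (i : ℕ) :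
    ∃ N, (i : ℝ) ^ 4 ≤ V N ∧ V N ≤ (i : ℝ) ^ 4 + 1 ∧ ∀ M, (i : ℝ) ^ 4 ≤ V M → N ≤ M := by
  classical
  have hex : ∃ N, (i : ℝ) ^ 4 ≤ V N := (htop.eventually_ge_atTop _).exists
  refine ⟨Nat.find hex, Nat.find_spec hex, ?_, fun M hM => Nat.find_min' hex hM⟩
  rcases Nat.eq_zero_or_pos (Nat.find hex) with h | h
  · rw [h, hV0]
    positivity
  · have h1 := Nat.find_min hex (Nat.sub_lt h one_pos)
    have h2 := hstep (Nat.find hex - 1)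
    rw [Nat.sub_add_cancel h] at h2
    linarith [not_le.mp h1]

/-- A monotone sequence which is asymptotic to `V` along the indices at which `V` reaches the
fourth powers is asymptotic to `V`. -/
theorem tendsto_div_of_tendsto_index {S V : ℕ → ℝ} (hS : Monotone S) (hS0 : ∀ N, 0 ≤ S N)
    (hV : Monotone V) (htop : Tendsto V atTop atTop) {idx : ℕ → ℕ}
    (h1 : ∀ i : ℕ, (i : ℝ) ^ 4 ≤ V (idx i)) (h2 : ∀ i : ℕ, V (idx i) ≤ (i : ℝ) ^ 4 + 1)
    (h3 : ∀ (i M : ℕ), (i : ℝ) ^ 4 ≤ V M → idx i ≤ M)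
    (hlim : Tendsto (fun i => S (idx i) / V (idx i)) atTop (nhds 1)) :
    Tendsto (fun N => S N / V N) atTop (nhds 1) := by
  -- `N` lies between the indices attached to `r N` and `r N + 1`.
  set r : ℕ → ℕ := fun N => ⌊√√(V N)⌋₊ with hr
  have hrtop : Tendsto r atTop atTop :=
    tendsto_nat_floor_atTop.comp (Real.tendsto_sqrt_atTop.comp (Real.tendsto_sqrt_atTop.comp htop))
  have hratio := tendsto_div_one_of_pow_four (U := fun i => V (idx i)) h1 h2
  have hlow : Tendsto (fun i => S (idx i) / V (idx i) / (V (idx (i + 1)) / V (idx i))) atTop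
      (nhds 1) := by
    have h := hlim.div hratio one_ne_zero
    rwa [div_one] at h
  have hupp : Tendsto (fun i => S (idx (i + 1)) / V (idx (i + 1)) *
      (V (idx (i + 1)) / V (idx i))) atTop (nhds 1) := by
    have h := (hlim.comp (tendsto_add_atTop_nat 1)).mul hratio
    rwa [mul_one] at h
  have hr4 : ∀ᶠ N in atTop,
      1 ≤ r N ∧ ((r N : ℕ) : ℝ) ^ 4 ≤ V N ∧ V N < ((r N + 1 : ℕ) : ℝ) ^ 4 := by
    filter_upwards [hrtop.eventually_ge_atTop 1, htop.eventually_ge_atTop 0] with N hN hN0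
    have e : √√(V N) ^ 4 = V N := by
      rw [show (4 : ℕ) = 2 * 2 from rfl, pow_mul, Real.sq_sqrt (Real.sqrt_nonneg _),
        Real.sq_sqrt hN0]
    have f1 : ((r N : ℕ) : ℝ) ≤ √√(V N) := Nat.floor_le (Real.sqrt_nonneg _)
    have f2 : √√(V N) < ((r N + 1 : ℕ) : ℝ) := by
      push_cast
      exact Nat.lt_floor_add_one _
    refine ⟨hN, ?_, ?_⟩
    · calc ((r N : ℕ) : ℝ) ^ 4 ≤ √√(V N) ^ 4 := by gcongr
        _ = V N := e
    · calc V N = √√(V N) ^ 4 := e.symm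
        _ < _ := by gcongr
  refine tendsto_of_tendsto_of_tendsto_of_le_of_le' (hlow.comp hrtop) (hupp.comp hrtop) ?_ ?_
  all_goals
    filter_upwards [hr4] with N hN
    obtain ⟨hr1, hle, hlt⟩ := hN
    set i := r N
    have hVi : 0 < V (idx i) := lt_of_lt_of_le (by positivity) (h1 i)
    have hidx : idx i ≤ N := h3 i N hle
    have hidx' : N ≤ idx (i + 1) := by
      by_contra! hcon
      exact absurd ((h1 (i + 1)).trans (hV hcon.le)) (not_le.mpr hlt)
    have hVN : 0 < V N := hVi.trans_le (hV hidx)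
    have hVi' : 0 < V (idx (i + 1)) := hVN.trans_le (hV hidx')
    simp only [Function.comp_apply]
  · rw [div_div_div_cancel_right₀ hVi.ne']
    exact div_le_div₀ (hS0 _) (hS hidx) hVN (hV hidx')
  · rw [div_mul_div_cancel₀ hVi'.ne']
    exact div_le_div₀ (hS0 _) (hS hidx') hVi (hV hidx)

section AlmostEverywhere

variable {k : ℕ} {ψ : ℕ → ℝ}

theorem expectedCount_succ_le (hψ : ∀ n : ℕ, 1 ≤ n → ψ n ∈ Set.Icc (0 : ℝ) (1 / 2)) (N : ℕ) :
    expectedCount k ψ (N + 1) ≤ expectedCount k ψ N + 1 := by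
  rw [expectedCount, Finset.sum_Icc_succ_top (by omega)]
  have := hyperVol_le_one k (t := 2 ^ k * ψ (N + 1))
    (mul_nonneg (by positivity) (hψ (N + 1) (by omega)).1)
  exact add_le_add le_rfl this

theorem hyperCount_nonneg (N : ℕ) (α : Fin k → ℝ) : 0 ≤ hyperCount k ψ N α :=
  Finset.sum_nonneg fun _ _ => Set.indicator_nonneg (fun _ _ => zero_le_one) _

theorem hyperCount_mono (α : Fin k → ℝ) : Monotone fun N => hyperCount k ψ N α := by
  intro M N h
  exact Finset.sum_le_sum_of_subset_of_nonneg (Finset.Icc_subset_Icc_right h)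
    fun _ _ _ => Set.indicator_nonneg (fun _ _ => zero_le_one) _

theorem ae_cubeMeasure_tendsto (hk : 2 ≤ k)
    (hψ : ∀ n : ℕ, 1 ≤ n → ψ n ∈ Set.Icc (0 : ℝ) (1 / 2))
    (hanti : AntitoneOn ψ (Set.Ici 1)) (htop : Tendsto (expectedCount k ψ) atTop atTop) :
    ∀ᵐ α ∂cubeMeasure k,
      Tendsto (fun N => hyperCount k ψ N α / expectedCount k ψ N) atTop (nhds 1) := by
  set V := expectedCount k ψ with hV
  have hV0 : V 0 = 0 := by simp [hV, expectedCount]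
  choose idx h1 h2 h3 using exists_index hV0 (expectedCount_succ_le hψ) htop
  obtain ⟨C, hC0, hC⟩ := exists_integral_sq_le hk
  set X : ℕ → (Fin k → ℝ) → ℝ := fun i α => hyperCount k ψ (idx (i + 1)) α / V (idx (i + 1)) - 1
    with hX
  have hXm : ∀ i, Measurable (X i) := fun i =>
    ((measurable_hyperCount _).div_const _).sub_const _
  have hXint : ∀ i, ∫⁻ α, ENNReal.ofReal (X i α ^ 2) ∂cubeMeasure k ≤
      ENNReal.ofReal (2 * C * ((i + 1 : ℕ) ^ 2 : ℝ)⁻¹) := by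
    intro i
    set N := idx (i + 1) with hN
    have hi : (((i + 1 : ℕ) : ℝ)) ^ 4 ≤ V N := h1 (i + 1)
    have hi1 : (1 : ℝ) ≤ ((i + 1 : ℕ) : ℝ) := by exact_mod_cast Nat.le_add_left 1 i
    have hVN1 : 1 ≤ V N := (one_le_pow₀ hi1).trans hi
    have hVN : 0 < V N := by linarith
    have hsq : (((i + 1 : ℕ) : ℝ)) ^ 2 ≤ √(V N) := by
      apply Real.le_sqrt_of_sq_le
      rw [← pow_mul]
      exact hi
    have hs1 : 1 ≤ √(V N) := Real.one_le_sqrt.mpr hVN1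
    have e : ∀ α, X i α ^ 2 = (hyperCount k ψ N α - V N) ^ 2 * ((V N) ^ 2)⁻¹ := by
      intro α
      simp only [hX, ← hN]
      field_simp
    simp only [e]
    rw [← ofReal_integral_eq_lintegral_ofReal
      ((integral_hyperCount_sub_sq hψ N).1.mul_const _)
      (Eventually.of_forall fun α => by positivity), integral_mul_const]
    apply ENNReal.ofReal_le_ofReal
    have hb := hC ψ hψ hanti N
    have hss : √(V N) * √(V N) = V N := Real.mul_self_sqrt hVN.le
    calc (∫ α, (hyperCount k ψ N α - V N) ^ 2 ∂cubeMeasure k) * ((V N) ^ 2)⁻¹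
        ≤ C * (V N * (√(V N) + √(V N))) * ((V N) ^ 2)⁻¹ := by
          gcongr
          exact hb.trans (by gcongr)
      _ = 2 * C * (√(V N))⁻¹ := by
          have aux : ∀ s v : ℝ, s ≠ 0 → s * s = v →
              C * (v * (s + s)) * (v ^ 2)⁻¹ = 2 * C * s⁻¹ := by
            rintro s _ hs rfl
            field_simp
            ring
          exact aux _ _ (by positivity) hss
      _ ≤ 2 * C * ((i + 1 : ℕ) ^ 2 : ℝ)⁻¹ := by
          gcongr
  have hsum : ∑' i : ℕ, ENNReal.ofReal (2 * C * ((i + 1 : ℕ) ^ 2 : ℝ)⁻¹) ≠ ⊤ := by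
    have hs : Summable fun i : ℕ => 2 * C * ((i + 1 : ℕ) ^ 2 : ℝ)⁻¹ :=
      ((summable_nat_add_iff 1).mpr (Real.summable_nat_pow_inv.mpr (by norm_num))).mul_left _
    exact hs.tsum_ofReal_ne_top
  have hfin : ∫⁻ α, ∑' i, ENNReal.ofReal (X i α ^ 2) ∂cubeMeasure k ≠ ⊤ := by
    rw [lintegral_tsum fun i => ((hXm i).pow_const 2).ennreal_ofReal.aemeasurable]
    exact ne_top_of_le_ne_top hsum (ENNReal.tsum_le_tsum hXint)
  filter_upwards [ae_lt_top (Measurable.tsum fun i => ((hXm i).pow_const 2).ennreal_ofReal)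
    hfin] with α hα
  have hzero := ENNReal.tendsto_atTop_zero_of_tsum_ne_top hα.ne
  have hzero' : Tendsto (fun i => X i α ^ 2) atTop (nhds 0) := by
    have := (ENNReal.tendsto_toReal ENNReal.zero_ne_top).comp hzero
    refine this.congr fun i => ?_
    exact ENNReal.toReal_ofReal (sq_nonneg _)
  have hX0 : Tendsto (fun i => X i α) atTop (nhds 0) := by
    rw [tendsto_zero_iff_abs_tendsto_zero]
    have := (Real.continuous_sqrt.tendsto 0).comp hzero'
    rw [Real.sqrt_zero] at this
    exact this.congr fun i => Real.sqrt_sq_eq_abs _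
  refine tendsto_div_of_tendsto_index (hyperCount_mono α) (fun N => hyperCount_nonneg N α)
    (expectedCount_mono hψ) htop h1 h2 h3 ?_
  rw [← tendsto_add_atTop_iff_nat 1]
  simpa [hX] using hX0.add_const 1

theorem hyperCount_add_int (N : ℕ) (α : Fin k → ℝ) (z : Fin k → ℤ) :
    hyperCount k ψ N (α + fun i => (z i : ℝ)) = hyperCount k ψ N α := by
  have h : ∀ n : ℕ, (α + fun i => (z i : ℝ)) ∈ hyperSet k n (ψ n) ↔ α ∈ hyperSet k n (ψ n) := by
    intro n
    have e : ∀ i, distInt (n * (α i + z i)) = distInt (n * α i) := by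
      intro i
      rw [← distInt_add_int (n * α i) (n * z i)]
      push_cast
      ring_nf
    simp only [hyperSet, Set.mem_ofPred_eq, Pi.add_apply, e]
  refine Finset.sum_congr rfl fun n _ => ?_
  by_cases hα : α ∈ hyperSet k n (ψ n)
  · rw [Set.indicator_of_mem hα, Set.indicator_of_mem ((h n).mpr hα)]
    rfl
  · rw [Set.indicator_of_notMem hα, Set.indicator_of_notMem (mt (h n).mp hα)]

/-- A property invariant under integer translations which holds almost everywhere on the unit cube
holds almost everywhere. -/
theorem ae_of_ae_cubeMeasure {p : (Fin k → ℝ) → Prop}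
    (hper : ∀ (α : Fin k → ℝ) (z : Fin k → ℤ), p (α + fun i => (z i : ℝ)) → p α)
    (hp : ∀ᵐ α ∂cubeMeasure k, p α) : ∀ᵐ α : Fin k → ℝ ∂volume, p α := by
  have hcube : cubeMeasure k =
      (volume : Measure (Fin k → ℝ)).restrict (Set.univ.pi fun _ => Set.Ioc 0 1) := by
    rw [volume_pi, Measure.restrict_pi_pi]
    rfl
  have hall : ∀ z : Fin k → ℤ, ∀ᵐ α : Fin k → ℝ ∂volume,
      (α + fun i => (z i : ℝ)) ∈ Set.univ.pi (fun _ : Fin k => Set.Ioc (0 : ℝ) 1) →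
        p (α + fun i => (z i : ℝ)) := by
    intro z
    rw [hcube, ae_restrict_iff' (MeasurableSet.univ_pi fun _ => measurableSet_Ioc)] at hp
    exact (measurePreserving_add_right (volume : Measure (Fin k → ℝ))
      (fun i => (z i : ℝ))).quasiMeasurePreserving.ae hp
  filter_upwards [ae_all_iff.mpr hall] with α hα
  refine hper α (fun i => 1 - ⌈α i⌉) (hα _ fun i _ => ?_)
  have h1 := Int.le_ceil (α i)
  have h2 := Int.ceil_lt_add_one (α i)
  simp only [Pi.add_apply, Set.mem_Ioc]
  push_cast
  constructor <;> linarith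

/-! ### The expected count -/

theorem sum_Icc_one_eq_sum_range (f : ℕ → ℝ) (N : ℕ) :
    ∑ n ∈ Finset.Icc 1 N, f n = ∑ i ∈ Finset.range N, f (i + 1) := by
  induction N with
  | zero => simp
  | succ N ih => rw [Finset.sum_Icc_succ_top (by omega), Finset.sum_range_succ, ih]

/-- The leading term of `hyperVol k t` as `t → 0`. It may be negative for
`t > 1`, which can happen for `t = 2 ^ k * ψ n` and finitely many `n`. -/
def hyperVolMain (k : ℕ) (t : ℝ) : ℝ := t * ((-Real.log t) ^ (k - 1) / ((k - 1).factorial : ℝ))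

theorem hyperVolMain_bounds (hk : 2 ≤ k) {t : ℝ} (ht : 0 < t) (hL : 1 ≤ -Real.log t) :
    0 ≤ hyperVolMain k t ∧ hyperVolMain k t ≤ hyperVol k t ∧
      hyperVol k t - hyperVolMain k t ≤ (k.factorial / -Real.log t) * hyperVol k t := by
  obtain ⟨r, rfl⟩ : ∃ r, k = r + 2 := ⟨k - 2, by omega⟩
  have ht1 : t ≤ 1 := by
    by_contra! h
    linarith [Real.log_pos h]
  set L := -Real.log t with hLdef
  have hL0 : 0 < L := by linarith
  have hmain : hyperVolMain (r + 2) t = t * (L ^ (r + 1) / ((r + 1).factorial : ℝ)) := rfl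
  have hvol : hyperVol (r + 2) t =
      t * ∑ j ∈ Finset.range (r + 1), L ^ j / (j.factorial : ℝ) + hyperVolMain (r + 2) t := by
    rw [hyperVol_of_le ht1, Finset.sum_range_succ, mul_add, hmain]
  have h0 : 0 ≤ hyperVolMain (r + 2) t := by
    rw [hmain]
    positivity
  have hrest : 0 ≤ t * ∑ j ∈ Finset.range (r + 1), L ^ j / (j.factorial : ℝ) := by positivity
  refine ⟨h0, by linarith, ?_⟩
  have hle : ∑ j ∈ Finset.range (r + 1), L ^ j / (j.factorial : ℝ) ≤ (r + 1) * L ^ r := by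
    have : ∀ j ∈ Finset.range (r + 1), L ^ j / (j.factorial : ℝ) ≤ L ^ r := by
      intro j hj
      have hj' : j ≤ r := Nat.lt_succ_iff.mp (Finset.mem_range.mp hj)
      exact (div_le_self (by positivity) (by exact_mod_cast Nat.factorial_pos j)).trans
        (pow_le_pow_right₀ hL hj')
    have := Finset.sum_le_card_nsmul _ _ _ this
    simpa using this
  calc hyperVol (r + 2) t - hyperVolMain (r + 2) t
      = t * ∑ j ∈ Finset.range (r + 1), L ^ j / (j.factorial : ℝ) := by
        rw [hvol]
        ring
    _ ≤ t * ((r + 1) * L ^ r) := by gcongr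
    _ ≤ t * ((r + 2) * L ^ r) := by
        gcongr
        norm_num
    _ = ((r + 2).factorial / L) * hyperVolMain (r + 2) t := by
        rw [hmain, Nat.factorial_succ (r + 1)]
        push_cast
        field_simp
        ring
    _ ≤ ((r + 2).factorial / L) * hyperVol (r + 2) t := by
        gcongr
        linarith

theorem isLittleO_hyperVol_sub (hk : 2 ≤ k) {t : ℕ → ℝ} (ht0 : ∀ n, 0 ≤ t n)
    (ht : Tendsto t atTop (nhds 0)) :
    (fun n => hyperVol k (t n) - hyperVolMain k (t n)) =o[atTop] fun n => hyperVol k (t n) := by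
  rw [Asymptotics.isLittleO_iff]
  intro ε hε
  set M : ℝ := max 1 (k.factorial / ε) with hM
  filter_upwards [ht.eventually_lt_const (Real.exp_pos (-M))] with n hn
  rcases (ht0 n).eq_or_lt with h | h
  · rw [← h, hyperVol_zero_right]
    simp [hyperVolMain]
  · have hlog : M ≤ -Real.log (t n) := by
      have := Real.log_lt_log h hn
      rw [Real.log_exp] at this
      linarith
    have hL : 1 ≤ -Real.log (t n) := (le_max_left _ _).trans hlog
    obtain ⟨h1, h2, h3⟩ := hyperVolMain_bounds hk h hL
    rw [Real.norm_of_nonneg (by linarith), Real.norm_of_nonneg (h1.trans h2)]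
    refine h3.trans (mul_le_mul_of_nonneg_right ?_ (h1.trans h2))
    rw [div_le_iff₀ (by linarith), ← div_le_iff₀' hε]
    exact (le_max_right _ _).trans hlog

theorem two_pow_mul_PsiMul (N : ℕ) :
    2 ^ k * PsiMul k ψ N = ∑ n ∈ Finset.Icc 1 N, hyperVolMain k (2 ^ k * ψ n) := by
  rw [PsiMul, Finset.mul_sum, Finset.mul_sum]
  refine Finset.sum_congr rfl fun n _ => ?_
  rw [hyperVolMain]
  ring

/-- The summands of `2 ^ k Ψ_k` are at most those of the expected count, up to the finitely many
`n` for which `2 ^ k ψ(n)` is not small, so the latter is unbounded as well. -/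
theorem tendsto_expectedCount (hk : 2 ≤ k)
    (hψ : ∀ n : ℕ, 1 ≤ n → ψ n ∈ Set.Icc (0 : ℝ) (1 / 2)) (hlim : Tendsto ψ atTop (nhds 0))
    (hΨ : ¬ ∃ C : ℝ, ∀ N : ℕ, |PsiMul k ψ N| ≤ C) :
    Tendsto (expectedCount k ψ) atTop atTop := by
  rcases tendsto_atTop_of_monotone (expectedCount_mono (k := k) hψ) with h | ⟨l, hl⟩
  · exact h
  exfalso
  have hbdd : ∀ N, expectedCount k ψ N ≤ l := (expectedCount_mono hψ).ge_of_tendsto hl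
  have hlim' : Tendsto (fun n => 2 ^ k * ψ n) atTop (nhds 0) := by
    simpa using hlim.const_mul (2 ^ k)
  obtain ⟨n₀, hn₀⟩ := eventually_atTop.mp (hlim'.eventually_lt_const (Real.exp_pos (-1)))
  set c : ℕ → ℝ := fun n => if n < n₀ then |hyperVolMain k (2 ^ k * ψ n)| else 0 with hc
  have hterm : ∀ n, 1 ≤ n →
      |hyperVolMain k (2 ^ k * ψ n)| ≤ hyperVol k (2 ^ k * ψ n) + c n := by
    intro n hn
    have h0 : 0 ≤ 2 ^ k * ψ n := mul_nonneg (by positivity) (hψ n hn).1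
    have hv := hyperVol_nonneg k h0
    rcases lt_or_ge n n₀ with h | h
    · simp only [hc, if_pos h]
      linarith
    · simp only [hc, if_neg h.not_gt, add_zero]
      rcases h0.eq_or_lt with h0 | h0
      · rw [← h0, hyperVol_zero_right]
        simp [hyperVolMain]
      · have hL : 1 ≤ -Real.log (2 ^ k * ψ n) := by
          have := Real.log_lt_log h0 (hn₀ n h)
          rw [Real.log_exp] at this
          linarith
        obtain ⟨h1, h2, -⟩ := hyperVolMain_bounds hk h0 hL
        rwa [abs_of_nonneg h1]
  refine hΨ ⟨l + ∑ n ∈ Finset.range n₀, |hyperVolMain k (2 ^ k * ψ n)|, fun N => ?_⟩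
  have hcsum : ∑ n ∈ Finset.Icc 1 N, c n ≤
      ∑ n ∈ Finset.range n₀, |hyperVolMain k (2 ^ k * ψ n)| := by
    simp only [hc]
    rw [← Finset.sum_filter]
    refine Finset.sum_le_sum_of_subset_of_nonneg (fun n hn => ?_) fun _ _ _ => abs_nonneg _
    exact Finset.mem_range.mpr (Finset.mem_filter.mp hn).2
  have h2k : (1 : ℝ) ≤ 2 ^ k := one_le_pow₀ (by norm_num)
  calc |PsiMul k ψ N| ≤ 2 ^ k * |PsiMul k ψ N| := le_mul_of_one_le_left (abs_nonneg _) h2k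
    _ = |∑ n ∈ Finset.Icc 1 N, hyperVolMain k (2 ^ k * ψ n)| := by
        rw [← two_pow_mul_PsiMul, abs_mul, abs_of_nonneg (by linarith : (0 : ℝ) ≤ 2 ^ k)]
    _ ≤ ∑ n ∈ Finset.Icc 1 N, |hyperVolMain k (2 ^ k * ψ n)| := Finset.abs_sum_le_sum_abs _ _
    _ ≤ ∑ n ∈ Finset.Icc 1 N, (hyperVol k (2 ^ k * ψ n) + c n) :=
        Finset.sum_le_sum fun n hn => hterm n (Finset.mem_Icc.mp hn).1
    _ ≤ _ := by
        rw [Finset.sum_add_distrib]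
        exact add_le_add (hbdd N) hcsum

theorem isEquivalent_expectedCount (hk : 2 ≤ k)
    (hψ : ∀ n : ℕ, 1 ≤ n → ψ n ∈ Set.Icc (0 : ℝ) (1 / 2)) (hlim : Tendsto ψ atTop (nhds 0))
    (htop : Tendsto (expectedCount k ψ) atTop atTop) :
    Asymptotics.IsEquivalent atTop (expectedCount k ψ) fun N => 2 ^ k * PsiMul k ψ N := by
  have hlim' : Tendsto (fun n => 2 ^ k * ψ (n + 1)) atTop (nhds 0) := by
    simpa using (hlim.comp (tendsto_add_atTop_nat 1)).const_mul (2 ^ k)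
  have h0 : ∀ n, 0 ≤ 2 ^ k * ψ (n + 1) := fun n =>
    mul_nonneg (by positivity) (hψ (n + 1) (by omega)).1
  have hV : expectedCount k ψ =
      fun N => ∑ i ∈ Finset.range N, hyperVol k (2 ^ k * ψ (i + 1)) := by
    funext N
    exact sum_Icc_one_eq_sum_range _ N
  have h := (isLittleO_hyperVol_sub hk h0 hlim').sum_range
    (fun n => hyperVol_nonneg k (h0 n)) (by rw [← hV]; exact htop)
  rw [← hV] at h
  symm
  refine h.neg_left.congr_left fun N => ?_
  rw [Pi.sub_apply, two_pow_mul_PsiMul, sum_Icc_one_eq_sum_range, hV]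
  simp only [Finset.sum_sub_distrib]
  ring

theorem countMul_eq_hyperCount (N : ℕ) (α : Fin k → ℝ) :
    (countMul 0 α N ψ : ℝ) = hyperCount k ψ N α := by
  classical
  rw [countMul, hyperCount, Finset.card_filter]
  push_cast
  refine Finset.sum_congr rfl fun n _ => ?_
  simp only [Pi.zero_apply, sub_zero]
  by_cases h : ∏ i, distInt (n * α i) < ψ n
  · rw [if_pos h, Set.indicator_of_mem (by exact h), Pi.one_apply]
  · rw [if_neg h, Set.indicator_of_notMem (by exact h)]

theorem ae_isEquivalent_hyperCount (hk : 2 ≤ k)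
    (hψ : ∀ n : ℕ, 1 ≤ n → ψ n ∈ Set.Icc (0 : ℝ) (1 / 2))
    (hanti : AntitoneOn ψ (Set.Ici 1)) (hlim : Tendsto ψ atTop (nhds 0))
    (hΨ : ¬ ∃ C : ℝ, ∀ N : ℕ, |PsiMul k ψ N| ≤ C) :
    ∀ᵐ α : Fin k → ℝ ∂volume, Asymptotics.IsEquivalent atTop
      (fun N : ℕ => hyperCount k ψ N α) (fun N : ℕ => 2 ^ k * PsiMul k ψ N) := by
  have htop := tendsto_expectedCount hk hψ hlim hΨ
  have h := ae_of_ae_cubeMeasure (fun α z hα => by simpa only [hyperCount_add_int] using hα)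
    (ae_cubeMeasure_tendsto hk hψ hanti htop)
  filter_upwards [h] with α hα
  refine Asymptotics.IsEquivalent.trans ?_ (isEquivalent_expectedCount hk hψ hlim htop)
  rw [Asymptotics.isEquivalent_iff_tendsto_one]
  · exact hα
  · filter_upwards [htop.eventually_gt_atTop 0] with N hN using hN.ne'

theorem eventually_PsiMul_pos (hk : 2 ≤ k)
    (hψ : ∀ n : ℕ, 1 ≤ n → ψ n ∈ Set.Icc (0 : ℝ) (1 / 2)) (hlim : Tendsto ψ atTop (nhds 0))
    (hΨ : ¬ ∃ C : ℝ, ∀ N : ℕ, |PsiMul k ψ N| ≤ C) : ∀ᶠ N in atTop, 0 < PsiMul k ψ N := by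
  have htop := tendsto_expectedCount hk hψ hlim hΨ
  have h := (isEquivalent_expectedCount hk hψ hlim htop).tendsto_atTop htop
  filter_upwards [h.eventually_gt_atTop 0] with N hN
  exact pos_of_mul_pos_right hN (by positivity)

end AlmostEverywhere

end LittlewoodCounting

end

open LittlewoodCounting in
theorem theorem1p4 (k : ℕ) (hk : 2 ≤ k) (ψ : ℕ → ℝ)
    (hψ_range : ∀ n : ℕ, 1 ≤ n → ψ n ∈ Set.Icc (0 : ℝ) (1 / 2))
    (hψ_anti : AntitoneOn ψ (Set.Ici 1))
    (hψ_lim : Tendsto ψ atTop (nhds 0))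
    (hΨ : ¬ ∃ C : ℝ, ∀ N : ℕ, |LittlewoodCounting.PsiMul k ψ N| ≤ C) :
    (∀ᵐ α : Fin k → ℝ ∂volume,
      Asymptotics.IsEquivalent atTop
        (fun N : ℕ => (LittlewoodCounting.countMul 0 α N ψ : ℝ))
        (fun N : ℕ => 2 ^ k * LittlewoodCounting.PsiMul k ψ N)) ∧
    (∀ K : Set (Fin k → ℝ), MeasurableSet K → volume K < ⊤ →
      ∀ ε : ℝ, 0 < ε → ∃ E : Set (Fin k → ℝ), MeasurableSet E ∧
        volume E ≤ ENNReal.ofReal ε ∧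
        ∀ δ : ℝ, 0 < δ → ∃ N₀ : ℕ, ∀ N : ℕ, N₀ ≤ N → ∀ α ∈ K \ E,
          |(LittlewoodCounting.countMul 0 α N ψ : ℝ) -
              2 ^ k * LittlewoodCounting.PsiMul k ψ N| ≤
            δ * LittlewoodCounting.PsiMul k ψ N) := by
  simp only [countMul_eq_hyperCount]
  have hae := ae_isEquivalent_hyperCount hk hψ_range hψ_anti hψ_lim hΨ
  have hpos := eventually_PsiMul_pos hk hψ_range hψ_lim hΨ
  refine ⟨hae, fun K hK hKfin ε hε => ?_⟩
  have hlim : ∀ᵐ α : Fin k → ℝ ∂volume, α ∈ K →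
      Tendsto (fun N => hyperCount k ψ N α / (2 ^ k * PsiMul k ψ N)) atTop (nhds 1) := by
    filter_upwards [hae] with α hα _
    refine (Asymptotics.isEquivalent_iff_tendsto_one ?_).mp hα
    filter_upwards [hpos] with N hN using by positivity
  obtain ⟨E, -, hE, hEε, hunif⟩ := tendstoUniformlyOn_of_ae_tendsto
    (fun N => ((measurable_hyperCount N).div_const _).stronglyMeasurable)
    stronglyMeasurable_const hK hKfin.ne hlim hε
  refine ⟨E, hE, hEε, fun δ hδ => ?_⟩
  obtain ⟨N₀, hN₀⟩ := eventually_atTop.mp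
    ((Metric.tendstoUniformlyOn_iff.mp hunif (δ / 2 ^ k) (by positivity)).and hpos)
  refine ⟨N₀, fun N hN α hα => ?_⟩
  obtain ⟨h1, h2⟩ := hN₀ N hN
  have h3 := h1 α hα
  have h4 : 0 < 2 ^ k * PsiMul k ψ N := by positivity
  rw [Real.dist_eq, abs_sub_comm, div_sub_one h4.ne', abs_div, abs_of_pos h4,
    div_lt_div_iff₀ h4 (by positivity)] at h3
  have h5 : |hyperCount k ψ N α - 2 ^ k * PsiMul k ψ N| * 2 ^ k <
      δ * PsiMul k ψ N * 2 ^ k := by linarith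
  exact (lt_of_mul_lt_mul_right h5 (by positivity)).le
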